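/- Let $\Omega \subset \mathbf{C}^n$ be a domain (a non-empty connected open set), and write $\mathcal{O}(\Omega)$ for the holomorphic functions on $\Omega$. Let $\Delta \Subset \Omega$ be an analytic polyhedron of $\Omega$; that is, the closure $\bar\Delta$ is compact and contained in $\Omega$, and there are finitely many $\varphi_1, \dots, \varphi_m \in \mathcal{O}(\Omega)$ and an open set $U$ with $\bar\Delta \subset U \subset \Omega$ such that $$\Delta = \{z \in U : |\varphi_j(z)| < 1,\ 1 \le j \le m\}, \qquad \bar\Delta = \{z \in U : |\varphi_j(z)| \le 1,\ 1 \le j \le m\}.$$ Then every function $f$ that is holomorphic on a neighborhood of $\bar\Delta$ is uniformly approximated on $\bar\Delta$ by elements of $\mathcal{O}(\Omega)$: for every $\varepsilon > 0$ there is an $F \in \mathcal{O}(\Omega)$ with $|f(z) - F(z)| < \varepsilon$ for all $z \in \bar\Delta$. -/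

import Mathlib

/-- `f` belongs to `𝒪(K)`: it is holomorphic on some open neighbourhood of the set `K ⊆ ℂⁿ`. -/
def HolomorphicNear {n : ℕ} (f : (Fin n → ℂ) → ℂ) (K : Set (Fin n → ℂ)) : Prop :=
  ∃ V : Set (Fin n → ℂ), IsOpen V ∧ K ⊆ V ∧ DifferentiableOn ℂ f V

/-- `Δ ⋐ Ω` is an analytic polyhedron of `Ω`: its closure is compact and contained in `Ω`, and
there are finitely many functions `φ j`, holomorphic on all of `Ω`, and an open neighbourhood
`U ⊆ Ω` of the closure of `Δ` in which `Δ` is given by the strict inequalities `|φ j| < 1` and the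
closure of `Δ` by the inequalities `|φ j| ≤ 1`. Since the closure of `Δ` lies in `U`, the set `Δ`
is then a union of connected components of `{z ∈ Ω | ∀ j, |φ j z| < 1}`. -/
def IsAnalyticPolyhedron {n : ℕ} (Ω Δ : Set (Fin n → ℂ)) : Prop :=
  IsCompact (closure Δ) ∧ closure Δ ⊆ Ω ∧
    ∃ (m : ℕ) (φ : Fin m → (Fin n → ℂ) → ℂ) (U : Set (Fin n → ℂ)),
      (∀ j, DifferentiableOn ℂ (φ j) Ω) ∧ IsOpen U ∧ U ⊆ Ω ∧
        Δ = {z ∈ U | ∀ j, ‖φ j z‖ < 1} ∧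
        closure Δ = {z ∈ U | ∀ j, ‖φ j z‖ ≤ 1}

/-! Let K be the closure of Δ, let φ = (φ_1, …, φ_m), and let X be the graph of φ over K, a compact
set in ℂ^(n+m). Two facts give the theorem: X is its own hull with respect to entire functions
(`entireHull_graphOver`), and a function holomorphic near the hull of a compact set is a uniform
limit of entire functions there (Oka–Weil). Applied to (z, w) ↦ f z, they yield an entire G close to
f on X, and F z = G (z, φ z) is holomorphic on Ω.

Oka–Weil rests on the additive Cousin problem. Near a product of compact convex planar sets, a
Cauchy integral whose contour is broken at a real hyperplane splits a holomorphic function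
(`splitPair_pi`), and patching small boxes (`CousinOn.union`) then solves the problem. A further
condition p z ∈ D is traded for one more variable by extending functions from the graph of p
(`exists_extension_of_cousinTrivial`). Induction on the number of conditions reaches all polyhedra,
and the same trade reduces approximation to Taylor expansion on polydiscs.

The convexity of X is not formal, because the hull could have points over places far from K, where φ
need not be defined. Rossi's local maximum principle (`exists_re_nonneg_of_mem_entireHull`) excludes
them: at a point p of the hull outside X, no holomorphic Q with Q p = 0 can have negative real part
on the rest of the hull near p. But a function v that vanishes on X and is positive on the rest of
the hull would have its maximum over the hull at such a p, and v is chosen so convex in the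
plurisubharmonic sense that a Q of the forbidden kind exists there (`exists_holomorphic_support`).
-/

open Set Filter Topology Metric MeasureTheory

/-! ### Holomorphic dependence of integrals on parameters. -/

section ParametricIntegral

variable {E : Type*} [NormedAddCommGroup E] [NormedSpace ℂ E]

/-- Cauchy's estimate for the derivative of a bounded holomorphic function on a ball. -/
theorem norm_fderiv_le_of_norm_le_on_ball {f : E → ℂ} {c : E} {r M : ℝ} (hr : 0 < r)
    (hd : DifferentiableOn ℂ f (ball c r)) (hM : ∀ x ∈ ball c r, ‖f x‖ ≤ M) :
    ‖fderiv ℂ f c‖ ≤ 2 * M / r := by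
  refine Complex.norm_fderiv_le_div_of_mapsTo_ball hd (fun x hx => ?_) hr
  rw [mem_closedBall, dist_eq_norm]
  calc ‖f x - f c‖ ≤ ‖f x‖ + ‖f c‖ := norm_sub_le _ _
    _ ≤ 2 * M := by linarith [hM x hx, hM c (mem_ball_self hr)]

/-- The Lipschitz estimate for a bounded holomorphic function on a ball. -/
theorem norm_sub_le_of_norm_le_on_ball {f : E → ℂ} {c : E} {r M : ℝ} (hr : 0 < r)
    (hd : DifferentiableOn ℂ f (ball c r)) (hM : ∀ x ∈ ball c r, ‖f x‖ ≤ M) {x : E}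
    (hx : x ∈ ball c r) : ‖f x - f c‖ ≤ 2 * M / r * ‖x - c‖ := by
  have := Complex.dist_le_div_mul_dist_of_mapsTo_ball (R₂ := 2 * M) hd (fun x hx => ?_) hx
  · simpa [dist_eq_norm] using this
  rw [mem_closedBall, dist_eq_norm]
  calc ‖f x - f c‖ ≤ ‖f x‖ + ‖f c‖ := norm_sub_le _ _
    _ ≤ 2 * M := by linarith [hM x hx, hM c (mem_ball_self hr)]

/-- Uniform continuity on a closed ball times `T` makes nearby slices uniformly close, and Cauchy's
estimate passes this to their derivatives. It supplies the measurability needed for differentiating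
under the integral. -/
theorem continuousOn_fderiv_of_parametric [ProperSpace E] {F : E → ℝ → ℂ} {O : Set E}
    (hO : IsOpen O) {T : Set ℝ} (hT : IsCompact T)
    (hc : ContinuousOn (Function.uncurry F) (O ×ˢ T))
    (hd : ∀ t ∈ T, DifferentiableOn ℂ (fun x => F x t) O) {x₀ : E} (hx₀ : x₀ ∈ O) :
    ContinuousOn (fun t => fderiv ℂ (fun x => F x t) x₀) T := by
  obtain ⟨r, hr, hrO⟩ := nhds_basis_closedBall.mem_iff.1 (hO.mem_nhds hx₀)
  have hu := ((isCompact_closedBall x₀ r).prod hT).uniformContinuousOn_of_continuous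
    (hc.mono (prod_mono hrO subset_rfl))
  rw [Metric.uniformContinuousOn_iff] at hu
  rw [Metric.continuousOn_iff]
  intro t₀ ht₀ ε hε
  obtain ⟨δ, hδ, h⟩ := hu (ε * r / 4) (by positivity)
  refine ⟨δ, hδ, fun t ht htt => ?_⟩
  have hat : ∀ s ∈ T, DifferentiableAt ℂ (fun x => F x s) x₀ := fun s hs =>
    (hd s hs).differentiableAt (hO.mem_nhds hx₀)
  rw [dist_eq_norm, ← fderiv_fun_sub (hat t ht) (hat t₀ ht₀)]
  have hsub : ball x₀ r ⊆ O := ball_subset_closedBall.trans hrO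
  calc _ ≤ 2 * (ε * r / 4) / r := by
        refine norm_fderiv_le_of_norm_le_on_ball hr
          (((hd t ht).mono hsub).sub ((hd t₀ ht₀).mono hsub)) fun x hx => ?_
        have hx' := ball_subset_closedBall hx
        have := h (x, t) ⟨hx', ht⟩ (x, t₀) ⟨hx', ht₀⟩ (by simpa [Prod.dist_eq] using htt)
        rw [dist_eq_norm] at this
        exact this.le
    _ < ε := by
        rw [show 2 * (ε * r / 4) / r = ε / 2 by field_simp; norm_num]
        linarith

/-- An interval integral that depends holomorphically on a parameter is holomorphic. -/
theorem differentiableOn_intervalIntegral [ProperSpace E] {F : E → ℝ → ℂ} {O : Set E}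
    (hO : IsOpen O) {a b : ℝ} (hc : ContinuousOn (Function.uncurry F) (O ×ˢ uIcc a b))
    (hd : ∀ t ∈ uIcc a b, DifferentiableOn ℂ (fun x => F x t) O) :
    DifferentiableOn ℂ (fun x => ∫ t in a..b, F x t) O := by
  intro x₀ hx₀
  have hslice : ∀ x ∈ O, ContinuousOn (F x) (uIcc a b) := fun x hx =>
    hc.comp (f := fun t => (x, t)) (by fun_prop) fun t ht => ⟨hx, ht⟩
  obtain ⟨r, hr, hrO⟩ := nhds_basis_closedBall.mem_iff.1 (hO.mem_nhds hx₀)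
  obtain ⟨M, hM⟩ := ((isCompact_closedBall x₀ r).prod isCompact_uIcc).exists_bound_of_continuousOn
    (hc.mono (prod_mono hrO subset_rfl))
  have hmeas : ∀ {G : ℝ → ℂ}, ContinuousOn G (uIcc a b) →
      AEStronglyMeasurable G (volume.restrict (uIoc a b)) := fun hG =>
    (hG.mono uIoc_subset_uIcc).aestronglyMeasurable measurableSet_uIoc
  -- The ball of radius `r / 2` about a point of `ball x₀ (r / 2)` stays in `closedBall x₀ r`, so
  -- Cauchy's estimate gives this constant dominating bound.
  refine (intervalIntegral.hasFDerivAt_integral_of_dominated_of_fderiv_le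
    (F' := fun x t => fderiv ℂ (fun x => F x t) x) (bound := fun _ => 2 * M / (r / 2))
    (ball_mem_nhds x₀ (half_pos hr)) ?_ (hslice x₀ hx₀).intervalIntegrable ?_ ?_ (by simp)
    ?_).differentiableAt.differentiableWithinAt
  · filter_upwards [hO.mem_nhds hx₀] with x hx using hmeas (hslice x hx)
  · exact ((continuousOn_fderiv_of_parametric hO isCompact_uIcc hc hd hx₀).mono
      uIoc_subset_uIcc).aestronglyMeasurable measurableSet_uIoc
  · refine ae_of_all _ fun t ht x hx => ?_
    have hsub : ball x (r / 2) ⊆ closedBall x₀ r := by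
      intro y hy
      rw [mem_closedBall]
      have := dist_triangle y x x₀
      rw [mem_ball] at hx hy
      linarith
    exact norm_fderiv_le_of_norm_le_on_ball (half_pos hr)
      ((hd t (uIoc_subset_uIcc ht)).mono (hsub.trans hrO))
      fun y hy => hM (y, t) ⟨hsub hy, uIoc_subset_uIcc ht⟩
  · refine ae_of_all _ fun t ht x hx => ?_
    exact ((hd t (uIoc_subset_uIcc ht)).differentiableAt (hO.mem_nhds (hrO
      (ball_subset_closedBall (ball_subset_ball (by linarith) hx))))).hasFDerivAt

end ParametricIntegral

/-! ### Cauchy's integral formula on rectangles. -/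

section RectangleCauchy

open Complex

/-- The integral of `f` over the boundary of the rectangle `[x₁, x₂] × [y₁, y₂]`. -/
noncomputable def rectIntegral (f : ℂ → ℂ) (x₁ x₂ y₁ y₂ : ℝ) : ℂ :=
  (∫ x : ℝ in x₁..x₂, f (x + y₁ * I)) - (∫ x : ℝ in x₁..x₂, f (x + y₂ * I)) +
    I * (∫ y : ℝ in y₁..y₂, f (x₂ + y * I)) - I * (∫ y : ℝ in y₁..y₂, f (x₁ + y * I))

/-- The boundary of the rectangle `[x₁, x₂] × [y₁, y₂]`. -/
def rectFrame (x₁ x₂ y₁ y₂ : ℝ) : Set ℂ :=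
  {z | z ∈ Icc x₁ x₂ ×ℂ Icc y₁ y₂ ∧ (z.re = x₁ ∨ z.re = x₂ ∨ z.im = y₁ ∨ z.im = y₂)}

theorem mem_rectFrame_segments {x₁ x₂ y₁ y₂ : ℝ} (hx : x₁ ≤ x₂) (hy : y₁ ≤ y₂) :
    (∀ x ∈ uIcc x₁ x₂, (x + y₁ * I : ℂ) ∈ rectFrame x₁ x₂ y₁ y₂) ∧
    (∀ x ∈ uIcc x₁ x₂, (x + y₂ * I : ℂ) ∈ rectFrame x₁ x₂ y₁ y₂) ∧
    (∀ y ∈ uIcc y₁ y₂, (x₂ + y * I : ℂ) ∈ rectFrame x₁ x₂ y₁ y₂) ∧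
    (∀ y ∈ uIcc y₁ y₂, (x₁ + y * I : ℂ) ∈ rectFrame x₁ x₂ y₁ y₂) := by
  rw [uIcc_of_le hx, uIcc_of_le hy]
  refine ⟨fun x h => ?_, fun x h => ?_, fun x h => ?_, fun x h => ?_⟩ <;>
    simpa [rectFrame, mem_reProdIm, hx, hy] using h

theorem rectIntegral_congr {f g : ℂ → ℂ} {x₁ x₂ y₁ y₂ : ℝ} (hx : x₁ ≤ x₂) (hy : y₁ ≤ y₂)
    (h : EqOn f g (rectFrame x₁ x₂ y₁ y₂)) :
    rectIntegral f x₁ x₂ y₁ y₂ = rectIntegral g x₁ x₂ y₁ y₂ := by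
  obtain ⟨m1, m2, m3, m4⟩ := mem_rectFrame_segments hx hy
  unfold rectIntegral
  rw [intervalIntegral.integral_congr fun x hx => h (m1 x hx),
    intervalIntegral.integral_congr fun x hx => h (m2 x hx),
    intervalIntegral.integral_congr fun x hx => h (m3 x hx),
    intervalIntegral.integral_congr fun x hx => h (m4 x hx)]

theorem rectIntegral_add {f g : ℂ → ℂ} {x₁ x₂ y₁ y₂ : ℝ} (hx : x₁ ≤ x₂) (hy : y₁ ≤ y₂)
    (hf : ContinuousOn f (rectFrame x₁ x₂ y₁ y₂)) (hg : ContinuousOn g (rectFrame x₁ x₂ y₁ y₂)) :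
    rectIntegral (fun z => f z + g z) x₁ x₂ y₁ y₂ =
      rectIntegral f x₁ x₂ y₁ y₂ + rectIntegral g x₁ x₂ y₁ y₂ := by
  obtain ⟨m1, m2, m3, m4⟩ := mem_rectFrame_segments hx hy
  have key : ∀ {a b : ℝ} {γ : ℝ → ℂ}, Continuous γ →
      (∀ x ∈ uIcc a b, γ x ∈ rectFrame x₁ x₂ y₁ y₂) →
      ∫ x in a..b, (f (γ x) + g (γ x)) = (∫ x in a..b, f (γ x)) + ∫ x in a..b, g (γ x) :=
    fun hγ h => intervalIntegral.integral_add (hf.comp hγ.continuousOn h).intervalIntegrable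
      (hg.comp hγ.continuousOn h).intervalIntegrable
  unfold rectIntegral
  simp only
  rw [key (by fun_prop) m1, key (by fun_prop) m2, key (by fun_prop) m3, key (by fun_prop) m4]
  ring

theorem rectIntegral_const_mul (c : ℂ) (f : ℂ → ℂ) (x₁ x₂ y₁ y₂ : ℝ) :
    rectIntegral (fun z => c * f z) x₁ x₂ y₁ y₂ = c * rectIntegral f x₁ x₂ y₁ y₂ := by
  simp only [rectIntegral, intervalIntegral.integral_const_mul]
  ring

theorem integral_inv_sub_horizontal {x₁ x₂ y : ℝ} {w : ℂ} (hy : y ≠ w.im) :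
    ∫ x : ℝ in x₁..x₂, ((x : ℂ) + y * I - w)⁻¹ = log (x₂ + y * I - w) - log (x₁ + y * I - w) := by
  have hmem : ∀ x : ℝ, (x : ℂ) + y * I - w ∈ slitPlane := fun x =>
    Or.inr (by simpa using sub_ne_zero.2 hy)
  refine intervalIntegral.integral_eq_sub_of_hasDerivAt
    (f := fun x : ℝ => log ((x : ℂ) + y * I - w)) (fun x _ => ?_) ?_
  · have h1 : HasDerivAt (fun x : ℝ => (x : ℂ) + y * I - w) 1 x :=
      ((ofRealCLM.hasDerivAt (x := x)).add_const _).sub_const _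
    simpa using h1.clog_real (hmem x)
  · refine ContinuousOn.intervalIntegrable (ContinuousOn.inv₀ (by fun_prop) fun x _ => ?_)
    exact slitPlane_ne_zero (hmem x)

theorem integral_inv_sub_vertical {x y₁ y₂ : ℝ} {w : ℂ} (hx : w.re < x) :
    I * ∫ y : ℝ in y₁..y₂, ((x : ℂ) + y * I - w)⁻¹ =
      log (x + y₂ * I - w) - log (x + y₁ * I - w) := by
  have hmem : ∀ y : ℝ, (x : ℂ) + y * I - w ∈ slitPlane := fun y =>
    Or.inl (by simpa using hx)
  rw [← intervalIntegral.integral_const_mul]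
  refine intervalIntegral.integral_eq_sub_of_hasDerivAt
    (f := fun y : ℝ => log ((x : ℂ) + y * I - w)) (fun y _ => ?_) ?_
  · have h1 : HasDerivAt (fun y : ℝ => (x : ℂ) + y * I - w) I y := by
      simpa using (((ofRealCLM.hasDerivAt (x := y)).mul_const I).const_add (x : ℂ)).sub_const w
    simpa [div_eq_mul_inv] using h1.clog_real (hmem y)
  · refine ContinuousOn.intervalIntegrable (ContinuousOn.mul continuousOn_const
      (ContinuousOn.inv₀ (by fun_prop) fun y _ => ?_))
    exact slitPlane_ne_zero (hmem y)

/-- The left side of a rectangle around `w` crosses the branch cut of log (z - w), so log (-(z - w))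
serves as primitive. -/
theorem integral_inv_sub_vertical_left {x y₁ y₂ : ℝ} {w : ℂ} (hx : x < w.re) :
    I * ∫ y : ℝ in y₁..y₂, ((x : ℂ) + y * I - w)⁻¹ =
      log (-(x + y₂ * I - w)) - log (-(x + y₁ * I - w)) := by
  have hmem : ∀ y : ℝ, -((x : ℂ) + y * I - w) ∈ slitPlane := fun y =>
    Or.inl (by simpa using hx)
  rw [← intervalIntegral.integral_const_mul]
  refine intervalIntegral.integral_eq_sub_of_hasDerivAt
    (f := fun y : ℝ => log (-((x : ℂ) + y * I - w))) (fun y _ => ?_) ?_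
  · have h1 : HasDerivAt (fun y : ℝ => -((x : ℂ) + y * I - w)) (-I) y := by
      have h2 := ((((ofRealCLM.hasDerivAt (x := y)).mul_const I).const_add (x : ℂ)).sub_const w).neg
      rwa [ofRealCLM_apply, ofReal_one, one_mul] at h2
    have := h1.clog_real (hmem y)
    rwa [neg_div_neg_eq, div_eq_mul_inv] at this
  · refine ContinuousOn.intervalIntegrable (ContinuousOn.mul continuousOn_const
      (ContinuousOn.inv₀ (by fun_prop) fun y _ => ?_))
    exact neg_ne_zero.1 (slitPlane_ne_zero (hmem y))

/-- The logarithms at the corners cancel except for the change of branch on the left side, which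
contributes πi at each of its two ends. -/
theorem rectIntegral_inv_sub {x₁ x₂ y₁ y₂ : ℝ} {w : ℂ} (hw : w ∈ Ioo x₁ x₂ ×ℂ Ioo y₁ y₂) :
    rectIntegral (fun z => (z - w)⁻¹) x₁ x₂ y₁ y₂ = 2 * Real.pi * I := by
  obtain ⟨⟨hx₁, hx₂⟩, hy₁, hy₂⟩ := hw
  unfold rectIntegral
  simp only
  rw [integral_inv_sub_horizontal hy₁.ne, integral_inv_sub_horizontal hy₂.ne',
    integral_inv_sub_vertical hx₂, integral_inv_sub_vertical_left hx₁]
  have e2 : log (-(x₁ + y₂ * I - w)) = log (x₁ + y₂ * I - w) - Real.pi * I := by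
    rw [log, log, arg_neg_eq_arg_sub_pi_of_im_pos (by simpa using hy₂), norm_neg]
    push_cast; ring
  have e1 : log (-(x₁ + y₁ * I - w)) = log (x₁ + y₁ * I - w) + Real.pi * I := by
    rw [log, log, arg_neg_eq_arg_add_pi_of_im_neg (by simpa using hy₁), norm_neg]
    push_cast; ring
  rw [e1, e2]; ring

/-- Cauchy's integral formula for a rectangle. -/
theorem rectIntegral_div_sub {f : ℂ → ℂ} {x₁ x₂ y₁ y₂ : ℝ} {V : Set ℂ} (hV : IsOpen V)
    (hf : DifferentiableOn ℂ f V) (hsub : Icc x₁ x₂ ×ℂ Icc y₁ y₂ ⊆ V) {w : ℂ}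
    (hw : w ∈ Ioo x₁ x₂ ×ℂ Ioo y₁ y₂) :
    rectIntegral (fun z => f z / (z - w)) x₁ x₂ y₁ y₂ = 2 * Real.pi * I * f w := by
  have hx : x₁ ≤ x₂ := (hw.1.1.trans hw.1.2).le
  have hy : y₁ ≤ y₂ := (hw.2.1.trans hw.2.2).le
  have hwV : V ∈ 𝓝 w := hV.mem_nhds (hsub ⟨Ioo_subset_Icc_self hw.1, Ioo_subset_Icc_self hw.2⟩)
  -- The quotient f z / (z - w) is the holomorphic `dslope f w`, whose boundary integral vanishes,
  -- plus f w / (z - w).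
  have hds : DifferentiableOn ℂ (dslope f w) V := (differentiableOn_dslope hwV).2 hf
  have hne : ∀ z ∈ rectFrame x₁ x₂ y₁ y₂, z ≠ w := by
    rintro z ⟨-, hz⟩ rfl
    obtain ⟨⟨h1, h2⟩, h3, h4⟩ := hw
    rcases hz with h | h | h | h <;> linarith
  have hfr : rectFrame x₁ x₂ y₁ y₂ ⊆ V := fun z hz => hsub hz.1
  have h0 : rectIntegral (dslope f w) x₁ x₂ y₁ y₂ = 0 := by
    have := integral_boundary_rect_eq_zero_of_differentiableOn (dslope f w)
      (x₁ + y₁ * I) (x₂ + y₂ * I) (hds.mono (by simpa [uIcc_of_le hx, uIcc_of_le hy] using hsub))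
    simpa [rectIntegral] using this
  have hcongr : EqOn (fun z => f z / (z - w)) (fun z => dslope f w z + f w * (z - w)⁻¹)
      (rectFrame x₁ x₂ y₁ y₂) := by
    intro z hz
    simp only [dslope_of_ne f (hne z hz), slope_def_field]
    ring
  rw [rectIntegral_congr hx hy hcongr, rectIntegral_add hx hy (hds.continuousOn.mono hfr),
    rectIntegral_const_mul, h0, rectIntegral_inv_sub hw]
  · ring
  · exact continuousOn_const.mul (ContinuousOn.inv₀ (by fun_prop) fun z hz =>
      sub_ne_zero.2 (hne z hz))

end RectangleCauchy

/-! ### Splitting a holomorphic function across a real hyperplane. -/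

section Splitting

/-- Every function that is holomorphic near `K₁ ∩ K₂` is the difference of a function that is
holomorphic near `K₁` and one that is holomorphic near `K₂`. -/
def SplitPair {E : Type*} [NormedAddCommGroup E] [NormedSpace ℂ E] (K₁ K₂ : Set E) : Prop :=
  ∀ (V : Set E) (g : E → ℂ), IsOpen V → K₁ ∩ K₂ ⊆ V → DifferentiableOn ℂ g V →
    ∃ (W₁ W₂ W₀ : Set E) (g₁ g₂ : E → ℂ), IsOpen W₁ ∧ IsOpen W₂ ∧ IsOpen W₀ ∧
      K₁ ⊆ W₁ ∧ K₂ ⊆ W₂ ∧ K₁ ∩ K₂ ⊆ W₀ ∧ DifferentiableOn ℂ g₁ W₁ ∧ DifferentiableOn ℂ g₂ W₂ ∧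
      ∀ x ∈ W₀, g x = g₁ x - g₂ x

variable {ι : Type} [Fintype ι] [DecidableEq ι]

theorem differentiable_update_const (i : ι) (w : ℂ) :
    Differentiable ℂ (fun z : ι → ℂ => Function.update z i w) := by
  rw [differentiable_pi]
  intro j
  by_cases h : j = i
  · subst h; simp
  · simp only [Function.update_of_ne h]; fun_prop

theorem differentiable_update_right (z : ι → ℂ) (i : ι) :
    Differentiable ℂ (fun w : ℂ => Function.update z i w) := fun w =>
  (hasFDerivAt_update z w).differentiableAt

theorem isOpen_setOf_forall_ne {X : Type*} [TopologicalSpace X] {u : X → ℂ} (hu : Continuous u)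
    {γ : ℝ → ℂ} (hγ : Continuous γ) {T : Set ℝ} (hT : IsCompact T) :
    IsOpen {x | ∀ t ∈ T, γ t ≠ u x} := by
  have : {x | ∀ t ∈ T, γ t ≠ u x} = u ⁻¹' (γ '' T)ᶜ := by ext x; simp
  rw [this]
  exact (hT.image hγ).isClosed.isOpen_compl.preimage hu

/-- The contour runs in the variable τ = a * z i, hence the division by `a`. Since `g` sees the i-th
coordinate only on the contour, `z i` itself is restricted merely to stay off it. -/
theorem differentiableOn_cauchySegment (i : ι) {V : Set (ι → ℂ)} {g : (ι → ℂ) → ℂ}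
    (hg : DifferentiableOn ℂ g V) (a : ℂ) {γ : ℝ → ℂ} (hγ : Continuous γ) {α β : ℝ}
    {N : Set (ι → ℂ)} (hN : IsOpen N)
    (hsub : ∀ z ∈ N, ∀ t ∈ uIcc α β, Function.update z i (γ t / a) ∈ V) :
    DifferentiableOn ℂ (fun z => ∫ t in α..β, g (Function.update z i (γ t / a)) / (γ t - a * z i))
      (N ∩ {z | ∀ t ∈ uIcc α β, γ t ≠ a * z i}) := by
  refine differentiableOn_intervalIntegral
    (F := fun z t => g (Function.update z i (γ t / a)) / (γ t - a * z i))
    (hN.inter (isOpen_setOf_forall_ne (by fun_prop) hγ isCompact_uIcc)) ?_ fun t ht => ?_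
  · refine ContinuousOn.div ?_ (by fun_prop) fun p hp => sub_ne_zero.2 (hp.1.2 _ hp.2)
    refine hg.continuousOn.comp (f := fun p : (ι → ℂ) × ℝ => Function.update p.1 i (γ p.2 / a))
      (Continuous.continuousOn ?_) fun p hp => hsub _ hp.1.1 _ hp.2
    exact continuous_fst.update i ((hγ.comp continuous_snd).div_const a)
  · have h1 : DifferentiableOn ℂ (fun z : ι → ℂ => g (Function.update z i (γ t / a)))
        (N ∩ {z | ∀ t ∈ uIcc α β, γ t ≠ a * z i}) :=
      hg.comp (differentiable_update_const i _).differentiableOn fun z hz => hsub _ hz.1 _ ht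
    have h2 : DifferentiableOn ℂ (fun z : ι → ℂ => γ t - a * z i)
        (N ∩ {z | ∀ t ∈ uIcc α β, γ t ≠ a * z i}) := by fun_prop
    simp only [div_eq_mul_inv] at h1 ⊢
    exact h1.fun_mul (h2.fun_inv fun z hz => sub_ne_zero.2 (hz.2 _ ht))

theorem rectIntegral_eq_right_add_left {f : ℂ → ℂ} {x₁ x₂ y₁ y₂ c : ℝ} (h₁ : x₁ ≤ c) (h₂ : c ≤ x₂)
    (hy : y₁ ≤ y₂) (hf : ContinuousOn f (rectFrame x₁ x₂ y₁ y₂)) :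
    rectIntegral f x₁ x₂ y₁ y₂ =
      ((∫ x : ℝ in c..x₂, f (x + y₁ * Complex.I)) - (∫ x : ℝ in c..x₂, f (x + y₂ * Complex.I)) +
        Complex.I * (∫ y : ℝ in y₁..y₂, f (x₂ + y * Complex.I))) +
      ((∫ x : ℝ in x₁..c, f (x + y₁ * Complex.I)) - (∫ x : ℝ in x₁..c, f (x + y₂ * Complex.I)) -
        Complex.I * (∫ y : ℝ in y₁..y₂, f (x₁ + y * Complex.I))) := by
  obtain ⟨m1, m2, -, -⟩ := mem_rectFrame_segments (h₁.trans h₂) hy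
  have hc : c ∈ uIcc x₁ x₂ := by rw [uIcc_of_le (h₁.trans h₂)]; exact ⟨h₁, h₂⟩
  have key : ∀ {y : ℝ}, (∀ x ∈ uIcc x₁ x₂, (x + y * Complex.I : ℂ) ∈ rectFrame x₁ x₂ y₁ y₂) →
      ∫ x in x₁..x₂, f (x + y * Complex.I) =
        (∫ x in x₁..c, f (x + y * Complex.I)) + ∫ x in c..x₂, f (x + y * Complex.I) := by
    intro y h
    have hcont : ContinuousOn (fun x : ℝ => f (x + y * Complex.I)) (uIcc x₁ x₂) :=
      hf.comp (f := fun x : ℝ => (x + y * Complex.I : ℂ)) (by fun_prop) h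
    exact (intervalIntegral.integral_add_adjacent_intervals
      (hcont.mono (uIcc_subset_uIcc_left hc)).intervalIntegrable
      (hcont.mono (uIcc_subset_uIcc_right hc)).intervalIntegrable).symm
  rw [rectIntegral, key m1, key m2]
  ring

/-- Cousin splitting for a product of compact convex sets cut by a real hyperplane. -/
theorem splitPair_pi {C : ι → Set ℂ} (hC : ∀ j, IsCompact (C j)) (hconv : ∀ j, Convex ℝ (C j))
    (i : ι) {a : ℂ} (ha : a ≠ 0) (c : ℝ) :
    SplitPair (pi univ C ∩ {z | (a * z i).re ≤ c}) (pi univ C ∩ {z | c ≤ (a * z i).re}) := by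
  intro V g hV hKV hg
  -- An empty intersection imposes no condition; otherwise the slice `Y` below is a nonempty
  -- interval.
  rcases (pi univ C ∩ {z | (a * z i).re ≤ c} ∩ (pi univ C ∩ {z | c ≤ (a * z i).re})).eq_empty_or_nonempty
    with he | hne
  · exact ⟨univ, univ, ∅, 0, 0, isOpen_univ, isOpen_univ, isOpen_empty, subset_univ _,
      subset_univ _, he.subset, differentiableOn_const 0, differentiableOn_const 0, by simp⟩
  set S := pi univ C ∩ {z | (a * z i).re ≤ c} ∩ (pi univ C ∩ {z | c ≤ (a * z i).re}) with hS
  have hK : IsCompact (pi univ C) := isCompact_univ_pi hC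
  have hcont : Continuous fun z : ι → ℂ => (a * z i).re := by fun_prop
  have hScpt : IsCompact S := (hK.inter_right (isClosed_le hcont continuous_const)).inter
    (hK.inter_right (isClosed_le continuous_const hcont))
  obtain ⟨δ, hδ, hδV⟩ := hScpt.exists_thickening_subset_open hV hKV
  -- the segment cut out of `C i`
  set Y : Set ℝ := {y | (c + y * Complex.I) / a ∈ C i} with hY
  have hYne : Y.Nonempty := by
    obtain ⟨z, ⟨hz, h1⟩, -, h2⟩ := hne
    refine ⟨(a * z i).im, ?_⟩
    have : (c : ℂ) + (a * z i).im * Complex.I = a * z i := by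
      rw [← le_antisymm (show (a * z i).re ≤ c from h1) h2]; exact Complex.re_add_im _
    rw [hY, mem_ofPred_eq, this, mul_div_cancel_left₀ _ ha]
    exact hz i (mem_univ i)
  have hYcpt : IsCompact Y := by
    have : Y = (fun w : ℂ => (a * w).im) '' (C i ∩ {w | (a * w).re = c}) := by
      ext y
      constructor
      · intro hy
        refine ⟨_, ⟨hy, ?_⟩, ?_⟩
        · change (a * _).re = c
          rw [mul_div_cancel₀ _ ha]; simp
        · simp only
          rw [mul_div_cancel₀ _ ha]; simp
      · rintro ⟨w, ⟨hw, h1⟩, rfl⟩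
        have : (c : ℂ) + (a * w).im * Complex.I = a * w := by
          rw [← show (a * w).re = c from h1]; exact Complex.re_add_im _
        rw [hY, mem_ofPred_eq]
        simp only
        rw [this, mul_div_cancel_left₀ _ ha]
        exact hw
    rw [this]
    refine ((hC i).inter_right (isClosed_eq (by fun_prop) continuous_const)).image (by fun_prop)
  have hYconv : Convex ℝ Y := by
    intro y hy y' hy' p q hp hq hpq
    have := hconv i hy hy' hp hq hpq
    rw [hY, mem_ofPred_eq]
    convert this using 1
    simp only [smul_eq_mul, Complex.real_smul]
    have hpq' : (p : ℂ) + q = 1 := by exact_mod_cast hpq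
    push_cast
    field_simp
    linear_combination (-(c : ℂ)) * hpq'
  obtain ⟨s, t, hst, hYst⟩ : ∃ s t, s ≤ t ∧ Y = Icc s t := by
    have := eq_Icc_of_connected_compact ⟨hYne, hYconv.isPreconnected⟩ hYcpt
    refine ⟨sInf Y, sSup Y, ?_, this⟩
    rw [← nonempty_Icc, ← this]; exact hYne
  -- Points of the rectangle of margin η around the slice are within 2η of it, hence within δ / 2 <
  -- δ after division by `a`.
  set η : ℝ := δ * ‖a‖ / 4 with hη
  have ha' : 0 < ‖a‖ := norm_pos_iff.2 ha
  have hηpos : 0 < η := by positivity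
  set N : Set (ι → ℂ) := {z | ∀ j, j ≠ i → z j ∈ thickening δ (C j)} with hN
  have hNo : IsOpen N := by
    have : N = ⋂ j, ⋂ (_ : j ≠ i), (fun z : ι → ℂ => z j) ⁻¹' thickening δ (C j) := by
      ext z; simp [hN]
    rw [this]
    exact isOpen_iInter_of_finite fun j => isOpen_iInter_of_finite fun _ =>
      isOpen_thickening.preimage (continuous_apply j)
  have hKN : pi univ C ⊆ N := fun z hz j _ => self_subset_thickening hδ _ (hz j (mem_univ j))
  have hNV : ∀ z ∈ N, ∀ τ ∈ Icc (c - η) (c + η) ×ℂ Icc (s - η) (t + η),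
      Function.update z i (τ / a) ∈ V := by
    intro z hz τ hτ
    obtain ⟨⟨hτ1, hτ2⟩, hτ3, hτ4⟩ := hτ
    have hx : ∀ j, ∃ x, j ≠ i → x ∈ C j ∧ dist (z j) x < δ := by
      intro j
      by_cases hj : j = i
      · exact ⟨0, fun h => (h hj).elim⟩
      · obtain ⟨x, hx, hx'⟩ := mem_thickening_iff.1 (hz j hj)
        exact ⟨x, fun _ => ⟨hx, hx'⟩⟩
    choose x hx using hx
    obtain ⟨y, hyY, hyτ⟩ : ∃ y ∈ Y, |τ.im - y| ≤ η := by
      rw [hYst]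
      refine ⟨max s (min t τ.im), ⟨le_max_left _ _, max_le hst (min_le_left _ _)⟩, ?_⟩
      rw [abs_le]
      rcases le_total t τ.im with h | h
      · rw [min_eq_left h, max_eq_right hst]; constructor <;> linarith
      · rw [min_eq_right h]
        rcases le_total s τ.im with h' | h'
        · rw [max_eq_right h']; constructor <;> linarith
        · rw [max_eq_left h']; constructor <;> linarith
    refine hδV (mem_thickening_iff.2 ⟨Function.update x i ((c + y * Complex.I) / a), ?_, ?_⟩)
    · have hmem : Function.update x i ((c + y * Complex.I) / a) ∈ pi univ C := by
        intro j _
        by_cases hj : j = i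
        · subst hj; rw [Function.update_self]; exact hyY
        · simpa [Function.update_of_ne hj] using (hx j hj).1
      have hre : (a * Function.update x i ((c + y * Complex.I) / a) i).re = c := by
        simp [mul_div_cancel₀ _ ha]
      exact ⟨⟨hmem, hre.le⟩, hmem, hre.ge⟩
    · rw [dist_pi_lt_iff hδ]
      intro j
      by_cases hj : j = i
      · subst hj
        rw [Function.update_self, Function.update_self, dist_eq_norm, ← sub_div, norm_div,
          div_lt_iff₀ ha']
        calc ‖τ - (c + y * Complex.I)‖ ≤ |(τ - (c + y * Complex.I)).re| +
              |(τ - (c + y * Complex.I)).im| := Complex.norm_le_abs_re_add_abs_im _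
          _ ≤ η + η := by
              refine add_le_add ?_ ?_
              · simp only [Complex.sub_re, Complex.add_re, Complex.ofReal_re, Complex.mul_re,
                  Complex.I_re, Complex.ofReal_im, Complex.I_im, mul_zero, zero_mul, sub_zero,
                  add_zero]
                rw [abs_le]; constructor <;> linarith
              · simpa using hyτ
          _ < δ * ‖a‖ := by rw [hη]; nlinarith [mul_pos hδ ha']
      · rw [Function.update_of_ne hj, Function.update_of_ne hj]
        exact (hx j hj).2
  have hyle : s - η ≤ t + η := by linarith
  -- the six oriented segments of the contour
  have seg : ∀ {γ : ℝ → ℂ} {α β : ℝ}, Continuous γ →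
      (∀ x ∈ uIcc α β, γ x ∈ Icc (c - η) (c + η) ×ℂ Icc (s - η) (t + η)) →
      DifferentiableOn ℂ
        (fun z => ∫ x in α..β, g (Function.update z i (γ x / a)) / (γ x - a * z i))
        (N ∩ {z | ∀ x ∈ uIcc α β, γ x ≠ a * z i}) := fun hγ h =>
    differentiableOn_cauchySegment i hg a hγ hNo fun z hz x hx => hNV z hz _ (h x hx)
  have hop : ∀ {γ : ℝ → ℂ} {α β : ℝ}, Continuous γ →
      IsOpen (N ∩ {z | ∀ x ∈ uIcc α β, γ x ≠ a * z i}) := fun hγ =>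
    hNo.inter (isOpen_setOf_forall_ne (by fun_prop) hγ isCompact_uIcc)
  have cH : ∀ y : ℝ, Continuous fun x : ℝ => (x : ℂ) + y * Complex.I := fun y => by fun_prop
  have cV : ∀ x : ℝ, Continuous fun y : ℝ => (x : ℂ) + y * Complex.I := fun y => by fun_prop
  have uR : uIcc c (c + η) = Icc c (c + η) := uIcc_of_le (by linarith)
  have uL : uIcc (c - η) c = Icc (c - η) c := uIcc_of_le (by linarith)
  have uV : uIcc (s - η) (t + η) = Icc (s - η) (t + η) := uIcc_of_le hyle
  have r1 := seg (α := c) (β := c + η) (cH (s - η)) (by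
    rw [uR]; rintro x ⟨h1, h2⟩; refine Complex.mem_reProdIm.2 ⟨⟨?_, ?_⟩, ?_, ?_⟩ <;> simp <;> linarith)
  have r2 := seg (α := c) (β := c + η) (cH (t + η)) (by
    rw [uR]; rintro x ⟨h1, h2⟩; refine Complex.mem_reProdIm.2 ⟨⟨?_, ?_⟩, ?_, ?_⟩ <;> simp <;> linarith)
  have r3 := seg (α := s - η) (β := t + η) (cV (c + η)) (by
    rw [uV]; rintro x ⟨h1, h2⟩; refine Complex.mem_reProdIm.2 ⟨⟨?_, ?_⟩, ?_, ?_⟩ <;> simp <;> linarith)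
  have l1 := seg (α := c - η) (β := c) (cH (s - η)) (by
    rw [uL]; rintro x ⟨h1, h2⟩; refine Complex.mem_reProdIm.2 ⟨⟨?_, ?_⟩, ?_, ?_⟩ <;> simp <;> linarith)
  have l2 := seg (α := c - η) (β := c) (cH (t + η)) (by
    rw [uL]; rintro x ⟨h1, h2⟩; refine Complex.mem_reProdIm.2 ⟨⟨?_, ?_⟩, ?_, ?_⟩ <;> simp <;> linarith)
  have l3 := seg (α := s - η) (β := t + η) (cV (c - η)) (by
    rw [uV]; rintro x ⟨h1, h2⟩; refine Complex.mem_reProdIm.2 ⟨⟨?_, ?_⟩, ?_, ?_⟩ <;> simp <;> linarith)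
  -- points of `K` on the line of the cut project into `Icc s t`
  have hline : ∀ z ∈ pi univ C, (a * z i).re = c → (a * z i).im ∈ Icc s t := by
    intro z hz hre
    rw [← hYst, hY, mem_ofPred_eq, ← hre, Complex.re_add_im, mul_div_cancel_left₀ _ ha]
    exact hz i (mem_univ i)
  have hout : ∀ z ∈ pi univ C, ∀ x y : ℝ, (x : ℂ) + y * Complex.I = a * z i →
      (a * z i).re = x ∧ (a * z i).im = y := by
    intro z _ x y h
    rw [← h]; simp
  -- The contour is broken at Re = c: its right part gives `g₁`, and minus its left part gives `g₂`.
  -- The right part meets Re ≤ c only at the heights `s - η` and `t + η`, outside the interval [s,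
  -- t] that contains the slice, so `g₁` is holomorphic near the left piece of the product; `g₂` is
  -- symmetric. Inside the rectangle the two parts add up to Cauchy's formula for `g`.
  refine ⟨_, _, N ∩ {z | a * z i ∈ Ioo (c - η) (c + η) ×ℂ Ioo (s - η) (t + η)},
    fun z => (2 * Real.pi * Complex.I)⁻¹ *
      ((∫ x in c..(c + η), g (Function.update z i ((x + (s - η : ℝ) * Complex.I) / a)) /
          (x + (s - η : ℝ) * Complex.I - a * z i)) -
        (∫ x in c..(c + η), g (Function.update z i ((x + (t + η : ℝ) * Complex.I) / a)) /
          (x + (t + η : ℝ) * Complex.I - a * z i)) +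
        Complex.I * ∫ y in (s - η)..(t + η),
          g (Function.update z i (((c + η : ℝ) + y * Complex.I) / a)) /
          ((c + η : ℝ) + y * Complex.I - a * z i)),
    fun z => -((2 * Real.pi * Complex.I)⁻¹ *
      ((∫ x in (c - η)..c, g (Function.update z i ((x + (s - η : ℝ) * Complex.I) / a)) /
          (x + (s - η : ℝ) * Complex.I - a * z i)) -
        (∫ x in (c - η)..c, g (Function.update z i ((x + (t + η : ℝ) * Complex.I) / a)) /
          (x + (t + η : ℝ) * Complex.I - a * z i)) -
        Complex.I * ∫ y in (s - η)..(t + η),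
          g (Function.update z i (((c - η : ℝ) + y * Complex.I) / a)) /
          ((c - η : ℝ) + y * Complex.I - a * z i))),
    ((hop (α := c) (β := c + η) (cH (s - η))).inter
      (hop (α := c) (β := c + η) (cH (t + η)))).inter
        (hop (α := s - η) (β := t + η) (cV (c + η))),
    ((hop (α := c - η) (β := c) (cH (s - η))).inter
      (hop (α := c - η) (β := c) (cH (t + η)))).inter
        (hop (α := s - η) (β := t + η) (cV (c - η))),
    hNo.inter (((isOpen_Ioo.reProdIm isOpen_Ioo)).preimage (by fun_prop)), ?_, ?_, ?_, ?_, ?_, ?_⟩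
  · rintro z ⟨hz, hzc⟩
    have hzc : (a * z i).re ≤ c := hzc
    refine ⟨⟨⟨hKN hz, fun x hx h => ?_⟩, hKN hz, fun x hx h => ?_⟩, hKN hz, fun y hy h => ?_⟩
    · obtain ⟨h1, h2⟩ := hout z hz _ _ h
      rw [uR] at hx
      have := hline z hz (le_antisymm hzc (h1 ▸ hx.1))
      rw [h2] at this; linarith [this.1]
    · obtain ⟨h1, h2⟩ := hout z hz _ _ h
      rw [uR] at hx
      have := hline z hz (le_antisymm hzc (h1 ▸ hx.1))
      rw [h2] at this; linarith [this.2]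
    · obtain ⟨h1, h2⟩ := hout z hz _ _ h
      linarith
  · rintro z ⟨hz, hzc⟩
    have hzc : c ≤ (a * z i).re := hzc
    refine ⟨⟨⟨hKN hz, fun x hx h => ?_⟩, hKN hz, fun x hx h => ?_⟩, hKN hz, fun y hy h => ?_⟩
    · obtain ⟨h1, h2⟩ := hout z hz _ _ h
      rw [uL] at hx
      have := hline z hz (le_antisymm (h1 ▸ hx.2) hzc)
      rw [h2] at this; linarith [this.1]
    · obtain ⟨h1, h2⟩ := hout z hz _ _ h
      rw [uL] at hx
      have := hline z hz (le_antisymm (h1 ▸ hx.2) hzc)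
      rw [h2] at this; linarith [this.2]
    · obtain ⟨h1, h2⟩ := hout z hz _ _ h
      linarith
  · rintro z ⟨⟨hz, h1⟩, -, h2⟩
    have hre : (a * z i).re = c := le_antisymm h1 h2
    have := hline z hz hre
    refine ⟨hKN hz, ⟨?_, ?_⟩, ?_, ?_⟩
    · rw [hre]; linarith
    · rw [hre]; linarith
    · linarith [this.1]
    · linarith [this.2]
  · refine DifferentiableOn.const_mul (DifferentiableOn.fun_add (DifferentiableOn.fun_sub ?_ ?_)
      (DifferentiableOn.const_mul ?_ _)) _
    · exact r1.mono fun z hz => hz.1.1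
    · exact r2.mono fun z hz => hz.1.2
    · exact r3.mono fun z hz => hz.2
  · refine (DifferentiableOn.const_mul (DifferentiableOn.fun_sub (DifferentiableOn.fun_sub ?_ ?_)
      (DifferentiableOn.const_mul ?_ _)) _).fun_neg
    · exact l1.mono fun z hz => hz.1.1
    · exact l2.mono fun z hz => hz.1.2
    · exact l3.mono fun z hz => hz.2
  · rintro z ⟨hzN, hz⟩
    have hVo : IsOpen ((fun w : ℂ => Function.update z i (w / a)) ⁻¹' V) := by
      refine hV.preimage (continuous_const.update i (by fun_prop))
    have hdf : DifferentiableOn ℂ (fun w : ℂ => g (Function.update z i (w / a)))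
        ((fun w : ℂ => Function.update z i (w / a)) ⁻¹' V) :=
      hg.comp (((differentiable_update_right z i).comp
        (differentiable_id.div_const a)).differentiableOn) fun w hw => hw
    have key := rectIntegral_div_sub hVo hdf (fun w hw => hNV z hzN w hw) hz
    have hfrne : ∀ w ∈ rectFrame (c - η) (c + η) (s - η) (t + η), w - a * z i ≠ 0 := by
      rintro w ⟨-, hw⟩ h0
      obtain ⟨⟨h1, h2⟩, h3, h4⟩ := hz
      rw [sub_eq_zero.1 h0] at hw
      rcases hw with h | h | h | h <;> linarith
    rw [rectIntegral_eq_right_add_left (c := c) (by linarith) (by linarith) hyle] at key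
    · simp only [mul_div_cancel_left₀ _ ha, Function.update_eq_self] at key
      have h2pi := Complex.two_pi_I_ne_zero
      rw [sub_neg_eq_add, ← mul_add, key, ← mul_assoc, inv_mul_cancel₀ h2pi, one_mul]
    · exact ContinuousOn.div (hdf.continuousOn.mono fun w hw => hNV z hzN w hw.1) (by fun_prop)
        hfrne

end Splitting

/-! ### Patching solutions of the additive Cousin problem. -/

section Cousin

variable {E : Type*} [NormedAddCommGroup E] [NormedSpace ℂ E]

/-- The additive Cousin datum `g` on `U₁ ∩ U₂` is a coboundary near `K`. -/
def CousinOn (U₁ U₂ : Set E) (g : E → ℂ) (K : Set E) : Prop :=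
  ∃ (W : Set E) (h₁ h₂ : E → ℂ), IsOpen W ∧ K ⊆ W ∧ DifferentiableOn ℂ h₁ (U₁ ∩ W) ∧
    DifferentiableOn ℂ h₂ (U₂ ∩ W) ∧ ∀ x ∈ U₁ ∩ U₂ ∩ W, g x = h₁ x - h₂ x

/-- Every additive Cousin datum for a cover of `K` by two open sets is a coboundary near `K`. -/
def CousinTrivial (K : Set E) : Prop :=
  ∀ (U₁ U₂ : Set E) (g : E → ℂ), IsOpen U₁ → IsOpen U₂ → K ⊆ U₁ ∪ U₂ →
    DifferentiableOn ℂ g (U₁ ∩ U₂) → CousinOn U₁ U₂ g K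

theorem CousinOn.mono {U₁ U₂ : Set E} {g : E → ℂ} {K K' : Set E} (h : CousinOn U₁ U₂ g K)
    (hK : K' ⊆ K) : CousinOn U₁ U₂ g K' := by
  obtain ⟨W, h₁, h₂, hW, hKW, r⟩ := h
  exact ⟨W, h₁, h₂, hW, hK.trans hKW, r⟩

theorem exists_differentiableOn_union {A B : Set E} (hA : IsOpen A) (hB : IsOpen B) {f f' : E → ℂ}
    (hf : DifferentiableOn ℂ f A) (hf' : DifferentiableOn ℂ f' B) (h : ∀ x ∈ A ∩ B, f x = f' x) :
    ∃ F : E → ℂ, DifferentiableOn ℂ F (A ∪ B) ∧ (∀ x ∈ A, F x = f x) ∧ ∀ x ∈ B, F x = f' x := by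
  classical
  have h1 : ∀ x ∈ A, A.piecewise f f' x = f x := fun x hx => piecewise_eq_of_mem _ _ _ hx
  have h2 : ∀ x ∈ B, A.piecewise f f' x = f' x := fun x hx => by
    by_cases hxA : x ∈ A
    · rw [h1 x hxA, h x ⟨hxA, hx⟩]
    · exact piecewise_eq_of_notMem _ _ _ hxA
  refine ⟨A.piecewise f f', DifferentiableOn.union_of_isOpen (hf.congr h1) (hf'.congr h2) hA hB,
    h1, h2⟩

theorem exists_open_inter_subset {X : Type*} [TopologicalSpace X] [T2Space X] {K₁ K₂ W : Set X}
    (h₁ : IsCompact K₁) (h₂ : IsCompact K₂) (hW : IsOpen W) (h : K₁ ∩ K₂ ⊆ W) :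
    ∃ N₁ N₂ : Set X, IsOpen N₁ ∧ IsOpen N₂ ∧ K₁ ⊆ N₁ ∧ K₂ ⊆ N₂ ∧ N₁ ∩ N₂ ⊆ W := by
  have hd : Disjoint (K₁ \ W) (K₂ \ W) := by
    rw [Set.disjoint_left]
    rintro x ⟨hx, hxW⟩ ⟨hx', -⟩
    exact hxW (h ⟨hx, hx'⟩)
  obtain ⟨A, B, hA, hB, hKA, hKB, hAB⟩ := SeparatedNhds.of_isCompact_isCompact (h₁.diff hW) (h₂.diff hW) hd
  refine ⟨A ∪ W, B ∪ W, hA.union hW, hB.union hW, fun x hx => ?_, fun x hx => ?_, ?_⟩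
  · by_cases hxW : x ∈ W
    · exact Or.inr hxW
    · exact Or.inl (hKA ⟨hx, hxW⟩)
  · by_cases hxW : x ∈ W
    · exact Or.inr hxW
    · exact Or.inl (hKB ⟨hx, hxW⟩)
  · rintro x ⟨hx | hx, hx' | hx'⟩
    · exact (Set.disjoint_left.1 hAB hx hx').elim
    all_goals assumption

/-- Near K₁ ∩ K₂ the two solutions differ by one function d, given by p - p' on U₁ and by q - q' on
U₂. Splitting d as a₁ - a₂ and subtracting a₁ from the first solution and a₂ from the second makes
them agree. -/
theorem CousinOn.union {U₁ U₂ : Set E} {g : E → ℂ} {K₁ K₂ : Set E} (hU₁ : IsOpen U₁)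
    (hU₂ : IsOpen U₂) (hK₁ : IsCompact K₁) (hK₂ : IsCompact K₂) (hcov : K₁ ∩ K₂ ⊆ U₁ ∪ U₂)
    (hsplit : SplitPair K₁ K₂) (h₁ : CousinOn U₁ U₂ g K₁) (h₂ : CousinOn U₁ U₂ g K₂) :
    CousinOn U₁ U₂ g (K₁ ∪ K₂) := by
  obtain ⟨W, p, q, hW, hKW, hp, hq, hpq⟩ := h₁
  obtain ⟨W', p', q', hW', hKW', hp', hq', hpq'⟩ := h₂
  obtain ⟨d, hd, hdp, hdq⟩ := exists_differentiableOn_union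
    (A := U₁ ∩ (W ∩ W')) (B := U₂ ∩ (W ∩ W')) (hU₁.inter (hW.inter hW')) (hU₂.inter (hW.inter hW'))
    ((hp.mono fun x hx => ⟨hx.1, hx.2.1⟩).sub (hp'.mono fun x hx => ⟨hx.1, hx.2.2⟩))
    ((hq.mono fun x hx => ⟨hx.1, hx.2.1⟩).sub (hq'.mono fun x hx => ⟨hx.1, hx.2.2⟩)) (by
      rintro x ⟨⟨h1, h2, h3⟩, h4, -⟩
      have e1 := hpq x ⟨⟨h1, h4⟩, h2⟩
      have e2 := hpq' x ⟨⟨h1, h4⟩, h3⟩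
      simp only [Pi.sub_apply]
      linear_combination e2 - e1)
  obtain ⟨W₁, W₂, W₀, a₁, a₂, hW₁, hW₂, hW₀, hKW₁, hKW₂, hKW₀, ha₁, ha₂, ha⟩ :=
    hsplit _ d ((hU₁.inter (hW.inter hW')).union (hU₂.inter (hW.inter hW'))) (by
      rintro x ⟨hx, hx'⟩
      rcases hcov ⟨hx, hx'⟩ with h | h
      · exact Or.inl ⟨h, hKW hx, hKW' hx'⟩
      · exact Or.inr ⟨h, hKW hx, hKW' hx'⟩) hd
  -- The identity d = a₁ - a₂ is known only on `W₀`, so the two domains are shrunk until they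
  -- overlap inside `W₀`.
  obtain ⟨N₁, N₂, hN₁, hN₂, hKN₁, hKN₂, hN⟩ := exists_open_inter_subset hK₁ hK₂ hW₀ hKW₀
  set M₁ := W ∩ W₁ ∩ N₁ with hM₁
  set M₂ := W' ∩ W₂ ∩ N₂ with hM₂
  have oM₁ : IsOpen M₁ := (hW.inter hW₁).inter hN₁
  have oM₂ : IsOpen M₂ := (hW'.inter hW₂).inter hN₂
  obtain ⟨F, hF, hF1, hF2⟩ := exists_differentiableOn_union (A := U₁ ∩ M₁) (B := U₁ ∩ M₂)
    (hU₁.inter oM₁) (hU₁.inter oM₂)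
    ((hp.mono fun x hx => ⟨hx.1, hx.2.1.1⟩).sub (ha₁.mono fun x hx => hx.2.1.2))
    ((hp'.mono fun x hx => ⟨hx.1, hx.2.1.1⟩).sub (ha₂.mono fun x hx => hx.2.1.2)) (by
      rintro x ⟨⟨h1, ⟨h2, h3⟩, h4⟩, -, ⟨h5, h6⟩, h7⟩
      have e1 := hdp x ⟨h1, h2, h5⟩
      have e2 := ha x (hN ⟨h4, h7⟩)
      simp only [Pi.sub_apply] at e1 ⊢
      linear_combination e2 - e1)
  obtain ⟨G, hG, hG1, hG2⟩ := exists_differentiableOn_union (A := U₂ ∩ M₁) (B := U₂ ∩ M₂)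
    (hU₂.inter oM₁) (hU₂.inter oM₂)
    ((hq.mono fun x hx => ⟨hx.1, hx.2.1.1⟩).sub (ha₁.mono fun x hx => hx.2.1.2))
    ((hq'.mono fun x hx => ⟨hx.1, hx.2.1.1⟩).sub (ha₂.mono fun x hx => hx.2.1.2)) (by
      rintro x ⟨⟨h1, ⟨h2, h3⟩, h4⟩, -, ⟨h5, h6⟩, h7⟩
      have e1 := hdq x ⟨h1, h2, h5⟩
      have e2 := ha x (hN ⟨h4, h7⟩)
      simp only [Pi.sub_apply] at e1 ⊢
      linear_combination e2 - e1)
  refine ⟨M₁ ∪ M₂, F, G, oM₁.union oM₂, ?_, by rwa [inter_union_distrib_left],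
    by rwa [inter_union_distrib_left], ?_⟩
  · rintro x (hx | hx)
    · exact Or.inl ⟨⟨hKW hx, hKW₁ hx⟩, hKN₁ hx⟩
    · exact Or.inr ⟨⟨hKW' hx, hKW₂ hx⟩, hKN₂ hx⟩
  · rintro x ⟨⟨h1, h2⟩, hx | hx⟩
    · rw [hF1 x ⟨h1, hx⟩, hG1 x ⟨h2, hx⟩, hpq x ⟨⟨h1, h2⟩, hx.1.1⟩]
      simp
    · rw [hF2 x ⟨h1, hx⟩, hG2 x ⟨h2, hx⟩, hpq' x ⟨⟨h1, h2⟩, hx.1.1⟩]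
      simp

theorem cousinOn_of_subset_left {U₁ U₂ : Set E} {g : E → ℂ} {K : Set E} (hU₁ : IsOpen U₁)
    (hg : DifferentiableOn ℂ g (U₁ ∩ U₂)) (hK : K ⊆ U₁) : CousinOn U₁ U₂ g K :=
  ⟨U₁, 0, -g, hU₁, hK, differentiableOn_const 0, (hg.mono (inter_comm _ _).subset).neg, by simp⟩

theorem cousinOn_of_subset_right {U₁ U₂ : Set E} {g : E → ℂ} {K : Set E} (hU₂ : IsOpen U₂)
    (hg : DifferentiableOn ℂ g (U₁ ∩ U₂)) (hK : K ⊆ U₂) : CousinOn U₁ U₂ g K :=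
  ⟨U₂, g, 0, hU₂, hK, hg, differentiableOn_const 0, by simp⟩

end Cousin

/-! ### Solving the Cousin problem by subdivision into small boxes. -/

section Subdivision

variable {ι : Type} [Fintype ι]

/-- A class of compact sets that is stable under cutting by the real hyperplanes
`Re (a * z i) = c`, with Cousin splitting for each cut. -/
structure CuttingClass (𝒮 : Set (Set (ι → ℂ))) : Prop where
  isCompact : ∀ K ∈ 𝒮, IsCompact K
  cut_le : ∀ K ∈ 𝒮, ∀ (i : ι) (a : ℂ) (c : ℝ), K ∩ {z | (a * z i).re ≤ c} ∈ 𝒮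
  cut_ge : ∀ K ∈ 𝒮, ∀ (i : ι) (a : ℂ) (c : ℝ), K ∩ {z | c ≤ (a * z i).re} ∈ 𝒮
  split : ∀ K ∈ 𝒮, ∀ (i : ι) (a : ℂ) (c : ℝ), a ≠ 0 →
    SplitPair (K ∩ {z | (a * z i).re ≤ c}) (K ∩ {z | c ≤ (a * z i).re})

/-- By compactness finitely many slabs of width δ cover `K`; they are attached one at a time, each
along a single hyperplane. -/
theorem CuttingClass.cousinOn_of_slabs {𝒮 : Set (Set (ι → ℂ))} (h𝒮 : CuttingClass 𝒮)
    {U₁ U₂ : Set (ι → ℂ)} {g : (ι → ℂ) → ℂ} (hU₁ : IsOpen U₁) (hU₂ : IsOpen U₂) (i : ι) {a : ℂ}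
    (ha : a ≠ 0) {δ : ℝ} (hδ : 0 < δ) {K : Set (ι → ℂ)} (hK : K ∈ 𝒮) (hcov : K ⊆ U₁ ∪ U₂)
    (h : ∀ c : ℝ, CousinOn U₁ U₂ g (K ∩ {z | c ≤ (a * z i).re} ∩ {z | (a * z i).re ≤ c + δ})) :
    CousinOn U₁ U₂ g K := by
  obtain ⟨M, hM⟩ := (h𝒮.isCompact K hK).exists_bound_of_continuousOn
    (f := fun z : ι → ℂ => (a * z i).re) (by fun_prop)
  have key : ∀ n : ℕ, CousinOn U₁ U₂ g
      (K ∩ {z | -M ≤ (a * z i).re} ∩ {z | (a * z i).re ≤ -M + n * δ}) := by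
    intro n
    induction n with
    | zero =>
      refine (h (-M)).mono ?_
      rintro z ⟨hz, hz'⟩
      refine ⟨hz, ?_⟩
      simp only [mem_ofPred_eq, Nat.cast_zero] at hz' ⊢
      linarith
    | succ n ih =>
      have hK' := h𝒮.cut_le _ (h𝒮.cut_ge K hK i a (-M)) i a (-M + (n + 1 : ℕ) * δ)
      have hc1 := h𝒮.cut_le _ hK' i a (-M + n * δ)
      have hc2 := h𝒮.cut_ge _ hK' i a (-M + n * δ)
      refine (CousinOn.union hU₁ hU₂ (h𝒮.isCompact _ hc1) (h𝒮.isCompact _ hc2)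
        (fun z hz => hcov hz.1.1.1.1) (h𝒮.split _ hK' i a (-M + n * δ) ha) (ih.mono ?_)
        ((h (-M + n * δ)).mono ?_)).mono ?_
      · rintro z ⟨⟨hz, -⟩, hz'⟩
        exact ⟨hz, hz'⟩
      · rintro z ⟨⟨⟨hz, -⟩, h1⟩, h2⟩
        refine ⟨⟨hz, h2⟩, ?_⟩
        simp only [mem_ofPred_eq] at h1 ⊢
        push_cast at h1
        linarith
      · intro z hz
        rcases le_total (a * z i).re (-M + n * δ) with h' | h'
        · exact Or.inl ⟨hz, h'⟩
        · exact Or.inr ⟨hz, h'⟩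
  obtain ⟨n, hn⟩ := exists_nat_ge (2 * M / δ)
  refine (key n).mono fun z hz => ?_
  have hb := abs_le.1 (hM z hz)
  rw [div_le_iff₀ hδ] at hn
  exact ⟨⟨hz, hb.1⟩, by simp only [mem_ofPred_eq]; linarith [hb.2]⟩

theorem CuttingClass.cousinOn_of_boxes {𝒮 : Set (Set (ι → ℂ))} (h𝒮 : CuttingClass 𝒮)
    {U₁ U₂ : Set (ι → ℂ)} {g : (ι → ℂ) → ℂ} (hU₁ : IsOpen U₁) (hU₂ : IsOpen U₂)
    {δ : ℝ} (hδ : 0 < δ) (T : Finset (ι × ℂ)) (hT : ∀ p ∈ T, p.2 ≠ 0) :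
    ∀ K ∈ 𝒮, K ⊆ U₁ ∪ U₂ →
    (∀ c : ι × ℂ → ℝ, CousinOn U₁ U₂ g
      (K ∩ {z | ∀ p ∈ T, c p ≤ (p.2 * z p.1).re ∧ (p.2 * z p.1).re ≤ c p + δ})) →
    CousinOn U₁ U₂ g K := by
  classical
  induction T using Finset.induction_on with
  | empty =>
    intro K _ _ h
    exact (h 0).mono fun z hz => ⟨hz, by simp⟩
  | insert p T hp ih =>
    intro K hK hcov h
    refine h𝒮.cousinOn_of_slabs hU₁ hU₂ p.1 (hT p (Finset.mem_insert_self _ _)) hδ hK hcov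
      fun c₀ => ?_
    refine ih (fun q hq => hT q (Finset.mem_insert_of_mem hq)) _
      (h𝒮.cut_le _ (h𝒮.cut_ge K hK _ _ _) _ _ _) (fun z hz => hcov hz.1.1) fun c => ?_
    refine (h (Function.update c p c₀)).mono ?_
    rintro z ⟨⟨⟨hz, h1⟩, h2⟩, h3⟩
    refine ⟨hz, fun q hq => ?_⟩
    rcases Finset.mem_insert.1 hq with rfl | hq'
    · rw [Function.update_self]; exact ⟨h1, h2⟩
    · rw [Function.update_of_ne (by rintro rfl; exact hp hq')]; exact h3 q hq'

theorem CuttingClass.cousinTrivial {𝒮 : Set (Set (ι → ℂ))} (h𝒮 : CuttingClass 𝒮)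
    {K : Set (ι → ℂ)} (hK : K ∈ 𝒮) : CousinTrivial K := by
  classical
  intro U₁ U₂ g hU₁ hU₂ hcov hg
  obtain ⟨δ, hδ, hδU⟩ := lebesgue_number_lemma_of_metric (h𝒮.isCompact K hK)
    (c := fun b : Bool => cond b U₁ U₂) (by rintro (_ | _) <;> assumption) (by
      intro x hx
      rcases hcov hx with h | h
      · exact mem_iUnion.2 ⟨true, h⟩
      · exact mem_iUnion.2 ⟨false, h⟩)
  -- The factors 1 and -i cut the real and the imaginary part of each coordinate. Boxes of side δ /
  -- 4 have sup-norm diameter at most δ / 2, below the Lebesgue number, so each lies in `U₁` or in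
  -- `U₂`, where the problem is trivial.
  refine h𝒮.cousinOn_of_boxes hU₁ hU₂ (δ := δ / 4) (by positivity)
    ((Finset.univ : Finset ι) ×ˢ {1, -Complex.I}) (by simp +contextual [or_imp]) K hK hcov
    fun c => ?_
  set P := K ∩ {z | ∀ p ∈ (Finset.univ : Finset ι) ×ˢ ({1, -Complex.I} : Finset ℂ),
    c p ≤ (p.2 * z p.1).re ∧ (p.2 * z p.1).re ≤ c p + δ / 4} with hP
  rcases P.eq_empty_or_nonempty with he | ⟨x, hx⟩
  · exact cousinOn_of_subset_left hU₁ hg (by simp [he])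
  have hPb : P ⊆ ball x δ := by
    intro z hz
    rw [mem_ball, dist_pi_lt_iff hδ]
    intro i
    have x1 := hx.2 (i, 1) (by simp)
    have x2 := hx.2 (i, -Complex.I) (by simp)
    have z1 := hz.2 (i, 1) (by simp)
    have z2 := hz.2 (i, -Complex.I) (by simp)
    simp only [one_mul, neg_mul, Complex.neg_re, Complex.I_mul_re, neg_neg] at x1 x2 z1 z2
    rw [dist_eq_norm]
    calc ‖z i - x i‖ ≤ |(z i - x i).re| + |(z i - x i).im| := Complex.norm_le_abs_re_add_abs_im _
      _ ≤ δ / 4 + δ / 4 := by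
        refine add_le_add (abs_le.2 ?_) (abs_le.2 ?_)
        · rw [Complex.sub_re]; constructor <;> linarith
        · rw [Complex.sub_im]; constructor <;> linarith
      _ < δ := by linarith
  obtain ⟨b, hb⟩ := hδU x hx.1
  cases b
  · exact cousinOn_of_subset_right hU₂ hg (hPb.trans hb)
  · exact cousinOn_of_subset_left hU₁ hg (hPb.trans hb)

end Subdivision

/-! ### Polyhedra and Oka's extension from a graph. -/

section Polyhedra

variable {ι : Type} [Fintype ι]

/-- Polyhedra `{z | z i ∈ C i, p j z ∈ D j}` with `m` entire functions `p j` and with all the sets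
`C i` and `D j` in the class `𝒞`. -/
def IsPolyhedron (𝒞 : Set (Set ℂ)) : ℕ → Set (ι → ℂ) → Prop
  | 0, K => ∃ C : ι → Set ℂ, (∀ i, C i ∈ 𝒞) ∧ K = univ.pi C
  | m + 1, K => ∃ (K₀ : Set (ι → ℂ)) (p : (ι → ℂ) → ℂ) (D : Set ℂ),
      IsPolyhedron 𝒞 m K₀ ∧ Differentiable ℂ p ∧ D ∈ 𝒞 ∧ K = K₀ ∩ p ⁻¹' D

theorem IsPolyhedron.mono {𝒞 𝒞' : Set (Set ℂ)} (h : 𝒞 ⊆ 𝒞') {m : ℕ} {K : Set (ι → ℂ)}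
    (hK : IsPolyhedron 𝒞 m K) : IsPolyhedron 𝒞' m K := by
  induction m generalizing K with
  | zero =>
    obtain ⟨C, hC, rfl⟩ := hK
    exact ⟨C, fun i => h (hC i), rfl⟩
  | succ m ih =>
    obtain ⟨K₀, p, D, hK₀, hp, hD, rfl⟩ := hK
    exact ⟨K₀, p, D, ih hK₀, hp, h hD, rfl⟩

/-- The compact convex subsets of `ℂ`. -/
def compactConvexSets : Set (Set ℂ) := {C | IsCompact C ∧ Convex ℝ C}

theorem IsPolyhedron.isCompact {m : ℕ} {K : Set (ι → ℂ)}
    (hK : IsPolyhedron compactConvexSets m K) : IsCompact K := by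
  induction m generalizing K with
  | zero =>
    obtain ⟨C, hC, rfl⟩ := hK
    exact isCompact_univ_pi fun i => (hC i).1
  | succ m ih =>
    obtain ⟨K₀, p, D, hK₀, hp, hD, rfl⟩ := hK
    exact (ih hK₀).inter_right (hD.1.isClosed.preimage hp.continuous)

theorem IsPolyhedron.inter_coord {m : ℕ} {K : Set (ι → ℂ)}
    (hK : IsPolyhedron compactConvexSets m K) (i : ι) {A : Set ℂ} (hA : IsClosed A)
    (hA' : Convex ℝ A) : IsPolyhedron compactConvexSets m (K ∩ {z | z i ∈ A}) := by
  classical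
  induction m generalizing K with
  | zero =>
    obtain ⟨C, hC, rfl⟩ := hK
    refine ⟨Function.update C i (C i ∩ A), fun j => ?_, ?_⟩
    · by_cases h : j = i
      · subst h
        rw [Function.update_self]
        exact ⟨(hC j).1.inter_right hA, (hC j).2.inter hA'⟩
      · rw [Function.update_of_ne h]; exact hC j
    · ext z
      simp only [mem_inter_iff, mem_univ_pi, mem_ofPred_eq]
      constructor
      · rintro ⟨h1, h2⟩ j
        by_cases h : j = i
        · subst h
          rw [Function.update_self]
          exact ⟨h1 j, h2⟩
        · rw [Function.update_of_ne h]; exact h1 j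
      · intro h
        have hi := h i
        rw [Function.update_self] at hi
        refine ⟨fun j => ?_, hi.2⟩
        by_cases hj : j = i
        · subst hj; exact hi.1
        · have := h j
          rwa [Function.update_of_ne hj] at this
  | succ m ih =>
    obtain ⟨K₀, p, D, hK₀, hp, hD, rfl⟩ := hK
    exact ⟨_, p, D, ih hK₀, hp, hD, inter_right_comm _ _ _⟩

theorem convex_setOf_re_mul_le (a : ℂ) (c : ℝ) : Convex ℝ {w : ℂ | (a * w).re ≤ c} :=
  convex_halfSpace_le (f := fun w : ℂ => (a * w).re)
    ⟨fun x y => by simp [mul_add], fun r x => by simp; ring⟩ c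

theorem convex_setOf_le_re_mul (a : ℂ) (c : ℝ) : Convex ℝ {w : ℂ | c ≤ (a * w).re} :=
  convex_halfSpace_ge (f := fun w : ℂ => (a * w).re)
    ⟨fun x y => by simp [mul_add], fun r x => by simp; ring⟩ c

/-- The product of `K ⊆ ℂ^ι` with `D ⊆ ℂ`, as a subset of `ℂ^(Option ι)`. -/
def prodOption (K : Set (ι → ℂ)) (D : Set ℂ) : Set (Option ι → ℂ) :=
  {x | (fun i => x (some i)) ∈ K ∧ x none ∈ D}

theorem IsPolyhedron.prodOption {𝒞 : Set (Set ℂ)} {m : ℕ} {K : Set (ι → ℂ)}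
    (hK : IsPolyhedron 𝒞 m K) {D : Set ℂ} (hD : D ∈ 𝒞) : IsPolyhedron 𝒞 m (prodOption K D) := by
  induction m generalizing K with
  | zero =>
    obtain ⟨C, hC, rfl⟩ := hK
    refine ⟨fun o => o.elim D C, ?_, ?_⟩
    · rintro (_ | i)
      · exact hD
      · exact hC i
    · ext x
      simp only [_root_.prodOption, mem_ofPred_eq, mem_univ_pi, Option.forall, Option.elim]
      exact and_comm
  | succ m ih =>
    obtain ⟨K₀, p, D', hK₀, hp, hD', rfl⟩ := hK
    refine ⟨_, fun x => p fun i => x (some i), D', ih hK₀, by fun_prop, hD', ?_⟩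
    ext x
    simp only [_root_.prodOption, mem_ofPred_eq, mem_inter_iff, mem_preimage]
    tauto

/-- The point of `ℂ^(Option ι)` with coordinates `w` and `z`. -/
def optionCons (w : ℂ) (z : ι → ℂ) : Option ι → ℂ := fun o => o.elim w z

theorem differentiable_optionCons {p : (ι → ℂ) → ℂ} (hp : Differentiable ℂ p) :
    Differentiable ℂ fun z => optionCons (p z) z := by
  rw [differentiable_pi]
  rintro (_ | i)
  · exact hp
  · exact differentiable_apply i

/-- Oka's extension principle: a function holomorphic near `K₀ ∩ p⁻¹(D)` is the restriction to the
graph of `p` of a function holomorphic near `K₀ × D`. -/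
theorem exists_extension_of_cousinTrivial {K₀ : Set (ι → ℂ)} {p : (ι → ℂ) → ℂ}
    (hp : Differentiable ℂ p) {D : Set ℂ} (hK : CousinTrivial (prodOption K₀ D))
    {V : Set (ι → ℂ)} (hV : IsOpen V) (hKV : K₀ ∩ p ⁻¹' D ⊆ V) {f : (ι → ℂ) → ℂ}
    (hf : DifferentiableOn ℂ f V) :
    ∃ (W : Set (Option ι → ℂ)) (F : (Option ι → ℂ) → ℂ), IsOpen W ∧ prodOption K₀ D ⊆ W ∧
      DifferentiableOn ℂ F W ∧ ∀ z ∈ V, optionCons (p z) z ∈ W → F (optionCons (p z) z) = f z := by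
  set r : (Option ι → ℂ) → (ι → ℂ) := fun x i => x (some i) with hr
  have hrd : Differentiable ℂ r := by rw [hr]; fun_prop
  set q : (Option ι → ℂ) → ℂ := fun x => x none - p (r x) with hq
  have hqd : Differentiable ℂ q := by
    have : Differentiable ℂ fun x : Option ι → ℂ => x none := differentiable_apply _
    exact this.sub (hp.comp hrd)
  set U₁ : Set (Option ι → ℂ) := r ⁻¹' V with hU₁
  set U₂ : Set (Option ι → ℂ) := {x | q x ≠ 0} with hU₂
  have oU₁ : IsOpen U₁ := hV.preimage hrd.continuous
  have oU₂ : IsOpen U₂ := isOpen_ne.preimage hqd.continuous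
  have hfr : DifferentiableOn ℂ (fun x => f (r x)) U₁ :=
    hf.comp hrd.differentiableOn fun x hx => hx
  -- The graph is {q = 0}. Solving f / q = h₁ - h₂ lets f - q h₁ on `U₁` and -q h₂ on `U₂` glue; the
  -- result equals f where q = 0.
  obtain ⟨W, h₁, h₂, hW, hKW, hh₁, hh₂, hh⟩ := hK U₁ U₂ (fun x => f (r x) * (q x)⁻¹) oU₁ oU₂ (by
    rintro x ⟨hx, hx'⟩
    by_cases h : q x = 0
    · refine Or.inl (hKV ⟨hx, ?_⟩)
      rw [mem_preimage, ← sub_eq_zero.1 h]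
      exact hx'
    · exact Or.inr h)
    ((hfr.mono inter_subset_left).fun_mul (hqd.differentiableOn.fun_inv fun x hx => hx.2))
  obtain ⟨F, hF, hF1, hF2⟩ := exists_differentiableOn_union (A := U₁ ∩ W) (B := U₂ ∩ W)
    (f := fun x => f (r x) - q x * h₁ x) (f' := fun x => - (q x * h₂ x))
    (oU₁.inter hW) (oU₂.inter hW)
    ((hfr.mono inter_subset_left).fun_sub (hqd.differentiableOn.fun_mul hh₁))
    (hqd.differentiableOn.fun_mul hh₂).fun_neg (by
      rintro x ⟨⟨h1, h2⟩, h3, -⟩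
      have e := hh x ⟨⟨h1, h3⟩, h2⟩
      have h3 : q x ≠ 0 := h3
      have e' : f (r x) = q x * (h₁ x - h₂ x) := by
        rw [← e]; field_simp
      rw [e']; ring)
  refine ⟨(U₁ ∪ U₂) ∩ W, F, (oU₁.union oU₂).inter hW, fun x hx => ⟨?_, hKW hx⟩, ?_, ?_⟩
  · by_cases h : q x = 0
    · refine Or.inl (hKV ⟨hx.1, ?_⟩)
      rw [mem_preimage]
      have := sub_eq_zero.1 h
      exact this ▸ hx.2
    · exact Or.inr h
  · rwa [union_inter_distrib_right]
  · rintro z hz ⟨-, hzW⟩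
    rw [hF1 _ ⟨hz, hzW⟩]
    have : q (optionCons (p z) z) = 0 := sub_self (p z)
    simp only [this, zero_mul, sub_zero]
    rfl

/-- The function is extended from the graph of `p` over K₁ ∩ K₂, split upstairs, and the two parts
are restricted to the graph. -/
theorem splitPair_of_prodOption {K₁ K₂ : Set (ι → ℂ)} {p : (ι → ℂ) → ℂ}
    (hp : Differentiable ℂ p) {D : Set ℂ} (hK : CousinTrivial (prodOption (K₁ ∩ K₂) D))
    (hs : SplitPair (prodOption K₁ D) (prodOption K₂ D)) :
    SplitPair (K₁ ∩ p ⁻¹' D) (K₂ ∩ p ⁻¹' D) := by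
  intro V g hV hKV hg
  obtain ⟨W, G, hW, hKW, hG, hGg⟩ := exists_extension_of_cousinTrivial hp hK hV
    (fun z hz => hKV ⟨⟨hz.1.1, hz.2⟩, hz.1.2, hz.2⟩) hg
  obtain ⟨W₁, W₂, W₀, g₁, g₂, hW₁, hW₂, hW₀, hKW₁, hKW₂, hKW₀, hg₁, hg₂, h⟩ := hs W G hW
    (fun x hx => hKW ⟨⟨hx.1.1, hx.2.1⟩, hx.1.2⟩) hG
  have hd := differentiable_optionCons hp
  refine ⟨(fun z => optionCons (p z) z) ⁻¹' W₁, (fun z => optionCons (p z) z) ⁻¹' W₂,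
    V ∩ (fun z => optionCons (p z) z) ⁻¹' (W ∩ W₀), fun z => g₁ (optionCons (p z) z),
    fun z => g₂ (optionCons (p z) z), hW₁.preimage hd.continuous, hW₂.preimage hd.continuous,
    hV.inter ((hW.inter hW₀).preimage hd.continuous), fun z hz => hKW₁ hz, fun z hz => hKW₂ hz,
    fun z hz => ⟨hKV hz, hKW ⟨⟨hz.1.1, hz.2.1⟩, hz.1.2⟩, hKW₀ ⟨hz.1, hz.2⟩⟩,
    hg₁.comp hd.differentiableOn fun z hz => hz, hg₂.comp hd.differentiableOn fun z hz => hz, ?_⟩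
  rintro z ⟨hzV, hzW, hzW₀⟩
  rw [← h _ hzW₀, hGg z hzV hzW]

end Polyhedra

/-- The induction ranges over all index types at once, since dropping a condition adds a coordinate.
The Cousin problem for `m` conditions is what yields splitting for `m + 1`. -/
theorem cuttingClass_isPolyhedron (m : ℕ) : ∀ (ι : Type) [Fintype ι],
    CuttingClass {K : Set (ι → ℂ) | IsPolyhedron compactConvexSets m K} := by
  induction m with
  | zero =>
    intro ι _
    classical
    refine ⟨fun K hK => IsPolyhedron.isCompact hK,
      fun K hK i a c => IsPolyhedron.inter_coord hK i (A := {w | (a * w).re ≤ c})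
        (isClosed_le (by fun_prop) continuous_const) (convex_setOf_re_mul_le a c),
      fun K hK i a c => IsPolyhedron.inter_coord hK i (A := {w | c ≤ (a * w).re})
        (isClosed_le continuous_const (by fun_prop)) (convex_setOf_le_re_mul a c), ?_⟩
    rintro K ⟨C, hC, rfl⟩ i a c ha
    exact splitPair_pi (fun j => (hC j).1) (fun j => (hC j).2) i ha c
  | succ m ih =>
    intro ι _
    classical
    have hle : ∀ {k : ℕ} {K : Set (ι → ℂ)}, IsPolyhedron compactConvexSets k K →
        ∀ (i : ι) (a : ℂ) (c : ℝ),
          IsPolyhedron compactConvexSets k (K ∩ {z | (a * z i).re ≤ c}) := fun hK i a c =>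
      IsPolyhedron.inter_coord hK i (A := {w | (a * w).re ≤ c})
        (isClosed_le (by fun_prop) continuous_const) (convex_setOf_re_mul_le a c)
    have hge : ∀ {k : ℕ} {K : Set (ι → ℂ)}, IsPolyhedron compactConvexSets k K →
        ∀ (i : ι) (a : ℂ) (c : ℝ),
          IsPolyhedron compactConvexSets k (K ∩ {z | c ≤ (a * z i).re}) := fun hK i a c =>
      IsPolyhedron.inter_coord hK i (A := {w | c ≤ (a * w).re})
        (isClosed_le continuous_const (by fun_prop)) (convex_setOf_le_re_mul a c)
    refine ⟨fun K hK => IsPolyhedron.isCompact hK, fun K hK => hle hK, fun K hK => hge hK, ?_⟩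
    rintro K ⟨K₀, p, D, hK₀, hp, hD, rfl⟩ i a c ha
    rw [inter_right_comm K₀ (p ⁻¹' D) {z | (a * z i).re ≤ c},
      inter_right_comm K₀ (p ⁻¹' D) {z | c ≤ (a * z i).re}]
    refine splitPair_of_prodOption hp ?_ ?_
    · refine (ih (Option ι)).cousinTrivial (IsPolyhedron.prodOption ?_ hD)
      have := hge (hle hK₀ i a c) i a c
      convert this using 1
      ext z; simp only [mem_inter_iff]; tauto
    · have := (ih (Option ι)).split _ (IsPolyhedron.prodOption hK₀ hD) (some i) a c ha
      convert this using 1 <;>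
      · ext x; simp only [prodOption, mem_inter_iff, mem_ofPred_eq]; tauto

/-- The additive Cousin problem is solvable near every polyhedron. -/
theorem IsPolyhedron.cousinTrivial {ι : Type} [Fintype ι] {m : ℕ} {K : Set (ι → ℂ)}
    (hK : IsPolyhedron compactConvexSets m K) : CousinTrivial K :=
  (cuttingClass_isPolyhedron m ι).cousinTrivial hK

/-! ### Entire approximation on polydiscs and polyhedra. -/

section PolydiscApproximation

variable {ι : Type} [Fintype ι] [DecidableEq ι]

theorem inv_sub_sub_geom_sum {w z : ℂ} (hw : w ≠ 0) (hwz : w - z ≠ 0) (n : ℕ) :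
    (w - z)⁻¹ - ∑ k ∈ Finset.range n, z ^ k * (w ^ (k + 1))⁻¹ = (z / w) ^ n * (w - z)⁻¹ := by
  induction n with
  | zero => simp
  | succ n ih =>
    rw [Finset.sum_range_succ, ← sub_sub, ih, div_pow, div_pow]
    field_simp
    ring

theorem isOpen_setOf_forall_norm_lt (T : Finset ι) (s : ι → ℝ) :
    IsOpen {z : ι → ℂ | ∀ i ∈ T, ‖z i‖ < s i} := by
  simp only [ofPred_forall]
  exact isOpen_biInter_finset fun i _ => isOpen_lt (by fun_prop) continuous_const

/-- The Taylor polynomial of order `n` in the variable `z i`, as a Cauchy integral. -/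
noncomputable def cauchyPartialSum (f : (ι → ℂ) → ℂ) (i : ι) (s : ℝ) (n : ℕ) (z : ι → ℂ) : ℂ :=
  (2 * Real.pi * Complex.I)⁻¹ • ∮ w in C(0, s),
    (∑ k ∈ Finset.range n, z i ^ k * (w ^ (k + 1))⁻¹) * f (Function.update z i w)

theorem differentiableOn_cauchyPartialSum {f : (ι → ℂ) → ℂ} {i : ι} {s : ℝ} (hs : 0 < s) (n : ℕ)
    {V N : Set (ι → ℂ)} (hf : DifferentiableOn ℂ f V) (hN : IsOpen N)
    (hsub : ∀ z ∈ N, ∀ w ∈ sphere (0 : ℂ) s, Function.update z i w ∈ V) :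
    DifferentiableOn ℂ (cauchyPartialSum f i s n) N := by
  have hmem : ∀ θ, circleMap 0 s θ ∈ sphere (0 : ℂ) s := fun θ => circleMap_mem_sphere _ hs.le θ
  have hne : ∀ θ, circleMap 0 s θ ≠ 0 := fun θ => circleMap_ne_center hs.ne'
  have key := differentiableOn_intervalIntegral (a := 0) (b := 2 * Real.pi)
    (F := fun z θ => deriv (circleMap 0 s) θ * ((∑ k ∈ Finset.range n, z i ^ k *
      (circleMap 0 s θ ^ (k + 1))⁻¹) * f (Function.update z i (circleMap 0 s θ))))
    hN ?_ fun θ _ => ?_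
  · exact (key.const_mul (2 * Real.pi * Complex.I)⁻¹ :)
  · simp only [deriv_circleMap, Function.uncurry_def]
    have hc : Continuous (circleMap 0 s) := continuous_circleMap 0 s
    refine ContinuousOn.mul (by fun_prop) (ContinuousOn.mul ?_ ?_)
    · refine Continuous.continuousOn (continuous_finsetSum _ fun k _ => ?_)
      refine Continuous.mul (by fun_prop) (Continuous.inv₀ (by fun_prop) fun p => ?_)
      exact pow_ne_zero _ (hne _)
    · refine hf.continuousOn.comp
        (f := fun p : (ι → ℂ) × ℝ => Function.update p.1 i (circleMap 0 s p.2))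
        (Continuous.continuousOn ?_) fun p hp => hsub _ hp.1 _ (hmem _)
      exact continuous_fst.update i (hc.comp continuous_snd)
  · refine DifferentiableOn.const_mul (DifferentiableOn.fun_mul ?_ ?_) _
    · fun_prop
    · exact hf.comp (differentiable_update_const i _).differentiableOn
        fun z hz => hsub _ hz _ (hmem _)

/-- The remainder of the geometric series for the Cauchy kernel is (z i / w)^n / (w - z i), which
decays uniformly for ‖z i‖ ≤ r < s = ‖w‖. -/
theorem norm_sub_cauchyPartialSum_le {f : (ι → ℂ) → ℂ} {i : ι} {r s M : ℝ} (hr : 0 ≤ r)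
    (hrs : r < s) (n : ℕ) {V : Set (ι → ℂ)} (hf : DifferentiableOn ℂ f V)
    {z : ι → ℂ} (hz : ‖z i‖ ≤ r) (hsub : ∀ w ∈ closedBall (0 : ℂ) s, Function.update z i w ∈ V)
    (hM : ∀ w ∈ closedBall (0 : ℂ) s, ‖f (Function.update z i w)‖ ≤ M) :
    ‖f z - cauchyPartialSum f i s n z‖ ≤ s * ((r / s) ^ n * (s - r)⁻¹ * M) := by
  have hs : 0 < s := hr.trans_lt hrs
  have hd : DifferentiableOn ℂ (fun w => f (Function.update z i w)) (closedBall 0 s) :=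
    hf.comp (differentiable_update_right z i).differentiableOn hsub
  have hzs : z i ∈ ball (0 : ℂ) s := by simpa using hz.trans_lt hrs
  have hcauchy := (hd.mono (closure_ball (0 : ℂ) hs.ne').subset).diffContOnCl.two_pi_i_inv_smul_circleIntegral_sub_inv_smul hzs
  rw [Function.update_eq_self] at hcauchy
  have hne : ∀ w ∈ sphere (0 : ℂ) s, w ≠ 0 ∧ w - z i ≠ 0 := by
    intro w hw
    have hw' : ‖w‖ = s := by simpa using hw
    constructor
    · rintro rfl; rw [norm_zero] at hw'; exact hs.ne hw'
    · intro h
      rw [sub_eq_zero.1 h] at hw'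
      linarith
  have hfc : ContinuousOn (fun w => f (Function.update z i w)) (sphere 0 s) :=
    hd.continuousOn.mono sphere_subset_closedBall
  have i1 : CircleIntegrable (fun w => (w - z i)⁻¹ • f (Function.update z i w)) 0 s :=
    ContinuousOn.circleIntegrable hs.le (((continuousOn_id.sub continuousOn_const).inv₀
      fun w hw => (hne w hw).2).smul hfc)
  have i2 : CircleIntegrable (fun w => (∑ k ∈ Finset.range n, z i ^ k * (w ^ (k + 1))⁻¹) *
      f (Function.update z i w)) 0 s := by
    refine ContinuousOn.circleIntegrable hs.le (ContinuousOn.mul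
      (continuousOn_finsetSum _ fun k _ => ?_) hfc)
    exact continuousOn_const.mul ((continuousOn_id.pow _).inv₀ fun w hw =>
      pow_ne_zero _ (hne w hw).1)
  rw [cauchyPartialSum, ← hcauchy, ← smul_sub, ← circleIntegral.integral_sub i1 i2]
  refine circleIntegral.norm_two_pi_i_inv_smul_integral_le_of_norm_le_const hs.le fun w hw => ?_
  have hw' : ‖w‖ = s := by simpa using hw
  rw [smul_eq_mul, ← sub_mul, inv_sub_sub_geom_sum (hne w hw).1 (hne w hw).2, norm_mul, norm_mul,
    norm_pow, norm_div, norm_inv, hw']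
  have h1 : s - r ≤ ‖w - z i‖ := by
    have := norm_sub_norm_le w (z i)
    rw [hw'] at this; linarith
  have h2 : 0 < s - r := sub_pos.2 hrs
  gcongr
  exact hM w (sphere_subset_closedBall hw)

/-- `T` lists the variables in which the domain is still bounded. A Taylor polynomial in one of them
is defined for every value of that variable, which removes it from `T`. -/
theorem exists_entire_approx_polydisc {r : ι → ℝ} (hr : ∀ i, 0 < r i) {δ : ℝ} (hδ : 0 < δ)
    (T : Finset ι) : ∀ f : (ι → ℂ) → ℂ, DifferentiableOn ℂ f {z | ∀ i ∈ T, ‖z i‖ < r i + δ} →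
    ∀ ε : ℝ, 0 < ε → ∃ F : (ι → ℂ) → ℂ, Differentiable ℂ F ∧
      ∀ z, (∀ i, ‖z i‖ ≤ r i) → ‖f z - F z‖ < ε := by
  induction T using Finset.induction_on with
  | empty =>
    intro f hf ε hε
    refine ⟨f, ?_, fun z _ => by simpa using hε⟩
    simpa [differentiableOn_univ] using hf
  | insert i T hi ih =>
    intro f hf ε hε
    set V := {z : ι → ℂ | ∀ j ∈ insert i T, ‖z j‖ < r j + δ} with hV
    set P : Set (ι → ℂ) := univ.pi fun j => closedBall (0 : ℂ) (r j + δ / 2) with hP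
    have hPc : IsCompact P := isCompact_univ_pi fun j => isCompact_closedBall _ _
    have hPV : P ⊆ V := by
      intro z hz j _
      have := mem_closedBall_zero_iff.1 (hz j (mem_univ j))
      linarith
    obtain ⟨M, hM⟩ := hPc.exists_bound_of_continuousOn (hf.continuousOn.mono hPV)
    set s := r i + δ / 2 with hs
    have hrs : r i < s := by rw [hs]; linarith
    have hs0 : 0 < s := (hr i).trans hrs
    have hmemP : ∀ z : ι → ℂ, (∀ j, ‖z j‖ ≤ r j) → ∀ w ∈ closedBall (0 : ℂ) s,
        Function.update z i w ∈ P := by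
      intro z hz w hw j _
      by_cases h : j = i
      · subst h; rw [Function.update_self]; exact hw
      · rw [Function.update_of_ne h, mem_closedBall_zero_iff]
        linarith [hz j]
    have hlim : Tendsto (fun n : ℕ => s * ((r i / s) ^ n * (s - r i)⁻¹ * M)) atTop (𝓝 0) := by
      have h1 := tendsto_pow_atTop_nhds_zero_of_lt_one (div_nonneg (hr i).le hs0.le)
        ((div_lt_one hs0).2 hrs)
      have h2 := ((h1.mul_const (s - r i)⁻¹).mul_const M).const_mul s
      simpa using h2
    obtain ⟨n, hn⟩ := (hlim.eventually (gt_mem_nhds (half_pos hε))).exists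
    obtain ⟨F, hF, hFa⟩ := ih (cauchyPartialSum f i s n)
      (differentiableOn_cauchyPartialSum hs0 n hf (isOpen_setOf_forall_norm_lt _ _) (by
        intro z hz w hw j hj
        by_cases h : j = i
        · subst h
          rw [Function.update_self, mem_sphere_zero_iff_norm.1 hw, hs]
          linarith
        · rw [Function.update_of_ne h]
          exact hz j ((Finset.mem_insert.1 hj).resolve_left h))) (ε / 2) (half_pos hε)
    refine ⟨F, hF, fun z hz => ?_⟩
    have e1 := norm_sub_cauchyPartialSum_le (hr i).le hrs n hf (hz i)
      (fun w hw => hPV (hmemP z hz w hw)) (fun w hw => hM _ (hmemP z hz w hw))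
    calc ‖f z - F z‖ = ‖(f z - cauchyPartialSum f i s n z) +
          (cauchyPartialSum f i s n z - F z)‖ := by congr 1; ring
      _ ≤ ‖f z - cauchyPartialSum f i s n z‖ + ‖cauchyPartialSum f i s n z - F z‖ :=
        norm_add_le _ _
      _ < ε := by linarith [hFa z hz]

end PolydiscApproximation

/-- The closed discs in `ℂ` that are centred at the origin and have positive radius. -/
def centredDiscs : Set (Set ℂ) := {C | ∃ r : ℝ, 0 < r ∧ C = closedBall 0 r}

theorem centredDiscs_subset : centredDiscs ⊆ compactConvexSets := by
  rintro C ⟨r, -, rfl⟩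
  exact ⟨isCompact_closedBall _ _, convex_closedBall _ _⟩

/-- Functions holomorphic near a polyhedron with disc-shaped conditions are uniform limits of entire
functions. -/
theorem IsPolyhedron.exists_entire_approx {m : ℕ} : ∀ {ι : Type} [Fintype ι] {K : Set (ι → ℂ)},
    IsPolyhedron centredDiscs m K → ∀ {V : Set (ι → ℂ)}, IsOpen V → K ⊆ V →
    ∀ {f : (ι → ℂ) → ℂ}, DifferentiableOn ℂ f V → ∀ {ε : ℝ}, 0 < ε →
    ∃ F : (ι → ℂ) → ℂ, Differentiable ℂ F ∧ ∀ z ∈ K, ‖f z - F z‖ < ε := by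
  induction m with
  | zero =>
    intro ι _ K hK V hV hKV f hf ε hε
    classical
    obtain ⟨C, hC, rfl⟩ := hK
    choose r hr hC using hC
    obtain ⟨δ, hδ, hδV⟩ := (isCompact_univ_pi fun i =>
      (centredDiscs_subset ⟨r i, hr i, hC i⟩).1).exists_thickening_subset_open hV hKV
    have hcyl : {z : ι → ℂ | ∀ i ∈ Finset.univ, ‖z i‖ < r i + δ} ⊆ V := by
      intro z hz
      refine hδV (mem_thickening_iff.2 ?_)
      have : ∀ i, ∃ x ∈ C i, dist (z i) x < δ := by
        intro i
        rw [← mem_thickening_iff, hC i, thickening_closedBall hδ (hr i).le,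
          mem_ball_zero_iff, add_comm]
        exact hz i (Finset.mem_univ i)
      choose x hx hx' using this
      exact ⟨x, fun i _ => hx i, (dist_pi_lt_iff hδ).2 hx'⟩
    obtain ⟨F, hF, h⟩ := exists_entire_approx_polydisc hr hδ Finset.univ f (hf.mono hcyl) ε hε
    refine ⟨F, hF, fun z hz => h z fun i => ?_⟩
    have := hz i (mem_univ i)
    rwa [hC i, mem_closedBall_zero_iff] at this
  | succ m ih =>
    intro ι _ K hK V hV hKV f hf ε hε
    obtain ⟨K₀, p, D, hK₀, hp, hD, rfl⟩ := hK
    obtain ⟨W, G, hW, hKW, hG, hGf⟩ := exists_extension_of_cousinTrivial hp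
      (IsPolyhedron.cousinTrivial ((hK₀.prodOption hD).mono centredDiscs_subset)) hV hKV hf
    obtain ⟨F, hF, h⟩ := ih (hK₀.prodOption hD) hW hKW hG hε
    refine ⟨fun z => F (optionCons (p z) z), hF.comp (differentiable_optionCons hp),
      fun z hz => ?_⟩
    have hz' : optionCons (p z) z ∈ _root_.prodOption K₀ D := hz
    rw [← hGf z (hKV hz) (hKW hz')]
    exact h _ hz'

/-! ### Hulls with respect to entire functions and the Oka–Weil theorem. -/

section Hull

variable {ι : Type} [Fintype ι]

/-- The hull of `X` with respect to the entire functions. -/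
def entireHull (X : Set (ι → ℂ)) : Set (ι → ℂ) :=
  {p | ∀ F : (ι → ℂ) → ℂ, Differentiable ℂ F → ∀ M : ℝ, 0 ≤ M → (∀ x ∈ X, ‖F x‖ ≤ M) → ‖F p‖ ≤ M}

theorem subset_entireHull (X : Set (ι → ℂ)) : X ⊆ entireHull X := fun x hx _ _ _ _ h => h x hx

theorem isClosed_entireHull (X : Set (ι → ℂ)) : IsClosed (entireHull X) := by
  simp only [entireHull, ofPred_forall]
  exact isClosed_iInter fun F => isClosed_iInter fun hF => isClosed_iInter fun M =>
    isClosed_iInter fun _ => isClosed_iInter fun _ =>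
      isClosed_le hF.continuous.norm continuous_const

theorem norm_apply_le_of_mem_entireHull {X : Set (ι → ℂ)} {R : ℝ} (hR : 0 ≤ R) {i : ι}
    (hX : ∀ x ∈ X, ‖x i‖ ≤ R) {p : ι → ℂ} (hp : p ∈ entireHull X) : ‖p i‖ ≤ R :=
  hp (fun z => z i) (differentiable_apply i) R hR hX

theorem isCompact_entireHull {X : Set (ι → ℂ)} (hX : IsCompact X) : IsCompact (entireHull X) := by
  obtain ⟨R, hR⟩ := hX.exists_bound_of_continuousOn continuousOn_id
  refine (isCompact_univ_pi fun _ : ι => isCompact_closedBall (0 : ℂ) (max R 0)).of_isClosed_subset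
    (isClosed_entireHull X) fun p hp i _ => ?_
  rw [mem_closedBall_zero_iff]
  exact norm_apply_le_of_mem_entireHull (le_max_right _ _)
    (fun x hx => ((norm_le_pi_norm x i).trans (hR x hx)).trans (le_max_left _ _)) hp

/-- The hull of a compact set has a neighbourhood basis of polyhedra. -/
theorem exists_isPolyhedron_of_entireHull_subset {X : Set (ι → ℂ)} (hX : IsCompact X)
    {W : Set (ι → ℂ)} (hW : IsOpen W) (hXW : entireHull X ⊆ W) :
    ∃ (m : ℕ) (K : Set (ι → ℂ)), IsPolyhedron centredDiscs m K ∧ entireHull X ⊆ K ∧ K ⊆ W := by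
  classical
  obtain ⟨R, hR⟩ := hX.exists_bound_of_continuousOn continuousOn_id
  have hR1 : (0 : ℝ) < max R 1 := lt_max_of_lt_right one_pos
  set P : Set (ι → ℂ) := univ.pi fun _ => closedBall (0 : ℂ) (max R 1) with hP
  have hXP : entireHull X ⊆ P := by
    intro p hp i _
    rw [mem_closedBall_zero_iff]
    exact norm_apply_le_of_mem_entireHull hR1.le
      (fun x hx => ((norm_le_pi_norm x i).trans (hR x hx)).trans (le_max_left _ _)) hp
  have hPc : IsCompact P := isCompact_univ_pi fun _ => isCompact_closedBall _ _
  have hsep : ∀ y ∈ P \ W, ∃ (F : (ι → ℂ) → ℂ) (s : ℝ), Differentiable ℂ F ∧ 0 < s ∧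
      (∀ x ∈ entireHull X, ‖F x‖ ≤ s) ∧ s < ‖F y‖ := by
    intro y hy
    have : y ∉ entireHull X := fun h => hy.2 (hXW h)
    simp only [entireHull, mem_ofPred_eq] at this
    push Not at this
    obtain ⟨F, hF, M, hM, h1, h2⟩ := this
    have : 0 < ‖F y‖ := hM.trans_lt h2
    -- The midpoint is positive even when `M = 0`, as the radius of a disc must be.
    exact ⟨F, (M + ‖F y‖) / 2, hF, by linarith,
      fun x hx => (hx F hF M hM h1).trans (by linarith), by linarith⟩
  choose! F s hF hs hFX hFy using hsep
  obtain ⟨t, htc⟩ := (hPc.diff hW).elim_nhds_subcover' (fun y _ => {z | s y < ‖F y z‖})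
    fun y hy => (isOpen_lt continuous_const (hF y hy).continuous.norm).mem_nhds (hFy y hy)
  have key : ∀ t : Finset ↥(P \ W), ∃ (m : ℕ) (K : Set (ι → ℂ)), IsPolyhedron centredDiscs m K ∧
      entireHull X ⊆ K ∧ K ⊆ P ∧ ∀ y ∈ t, ∀ z ∈ K, ‖F y z‖ ≤ s y := by
    intro t
    induction t using Finset.induction_on with
    | empty =>
      exact ⟨0, P, ⟨_, fun _ => ⟨_, hR1, rfl⟩, rfl⟩, hXP, subset_rfl, by simp⟩
    | insert y t hy ih =>
      obtain ⟨m, K, hK, hXK, hKP, h⟩ := ih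
      refine ⟨m + 1, K ∩ F y ⁻¹' closedBall 0 (s y),
        ⟨K, F y, _, hK, hF y y.2, ⟨s y, hs y y.2, rfl⟩, rfl⟩, fun x hx => ⟨hXK hx, ?_⟩,
        inter_subset_left.trans hKP, ?_⟩
      · rw [mem_preimage, mem_closedBall_zero_iff]
        exact hFX y y.2 x hx
      · rintro y' hy' z ⟨hz, hz'⟩
        rcases Finset.mem_insert.1 hy' with rfl | hy''
        · exact mem_closedBall_zero_iff.1 hz'
        · exact h y' hy'' z hz
  obtain ⟨m, K, hK, hXK, hKP, h⟩ := key t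
  refine ⟨m, K, hK, hXK, fun z hz => ?_⟩
  by_contra hzW
  obtain ⟨y, hy, hyz⟩ := mem_iUnion₂.1 (htc ⟨hKP hz, hzW⟩)
  exact absurd (h y hy z hz) (not_le.2 hyz)

/-- The Oka–Weil theorem. -/
theorem exists_entire_approx_of_entireHull_subset {X : Set (ι → ℂ)} (hX : IsCompact X)
    {V : Set (ι → ℂ)} (hV : IsOpen V) (hXV : entireHull X ⊆ V) {f : (ι → ℂ) → ℂ}
    (hf : DifferentiableOn ℂ f V) {ε : ℝ} (hε : 0 < ε) :
    ∃ F : (ι → ℂ) → ℂ, Differentiable ℂ F ∧ ∀ z ∈ entireHull X, ‖f z - F z‖ < ε := by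
  obtain ⟨m, K, hK, hXK, hKV⟩ := exists_isPolyhedron_of_entireHull_subset hX hV hXV
  obtain ⟨F, hF, h⟩ := hK.exists_entire_approx hV hKV hf hε
  exact ⟨F, hF, fun z hz => h z (hXK hz)⟩

/-- By Oka–Weil, the inequality defining the hull passes from entire functions to functions
holomorphic only near the hull. -/
theorem norm_le_of_mem_entireHull {X : Set (ι → ℂ)} (hX : IsCompact X)
    {V : Set (ι → ℂ)} (hV : IsOpen V) (hXV : entireHull X ⊆ V) {f : (ι → ℂ) → ℂ}
    (hf : DifferentiableOn ℂ f V) {M : ℝ} (hM : 0 ≤ M) (hfM : ∀ x ∈ X, ‖f x‖ ≤ M) {p : ι → ℂ}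
    (hp : p ∈ entireHull X) : ‖f p‖ ≤ M := by
  refine le_of_forall_pos_le_add fun ε hε => ?_
  obtain ⟨F, hF, h⟩ := exists_entire_approx_of_entireHull_subset hX hV hXV hf (half_pos hε)
  have h1 : ‖F p‖ ≤ M + ε / 2 := hp F hF _ (by positivity) fun x hx => by
    have := norm_sub_norm_le (F x) (f x)
    rw [norm_sub_rev] at this
    linarith [h x (subset_entireHull X hx), hfM x hx]
  have := norm_sub_norm_le (f p) (F p)
  linarith [h p hp]

end Hull

/-! ### Rossi's local maximum principle. -/

section LocalPeak

variable {ι : Type} [Fintype ι]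

theorem continuous_optionCons :
    Continuous fun q : ℂ × (ι → ℂ) => optionCons q.1 q.2 := by
  refine continuous_pi ?_
  rintro (_ | i)
  · exact continuous_fst
  · exact (continuous_apply i).comp continuous_snd

/-- Rossi's local maximum principle: a point of the hull outside `X` is not a local peak point. -/
theorem exists_re_nonneg_of_mem_entireHull {X : Set (ι → ℂ)} (hX : IsCompact X) {p : ι → ℂ}
    (hp : p ∈ entireHull X) (hpX : p ∉ X) {O : Set (ι → ℂ)} (hO : IsOpen O) (hpO : p ∈ O)
    {Q : (ι → ℂ) → ℂ} (hQ : DifferentiableOn ℂ Q O) (hQp : Q p = 0) :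
    ∃ z ∈ entireHull X ∩ O, z ≠ p ∧ 0 ≤ (Q z).re := by
  by_contra! hneg
  obtain ⟨r₀, hr₀, hr₀O⟩ := nhds_basis_closedBall.mem_iff.1
    ((hO.inter hX.isClosed.isOpen_compl).mem_nhds ⟨hpO, hpX⟩)
  obtain ⟨r, hr, rfl⟩ : ∃ r, 0 < r ∧ r₀ = 2 * r := ⟨r₀ / 2, by linarith, by ring⟩
  have hBO : closedBall p (2 * r) ⊆ O := fun z hz => (hr₀O hz).1
  have hre : ContinuousOn (fun z => (Q z).re) (closedBall p (2 * r)) :=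
    Complex.continuous_re.comp_continuousOn (hQ.continuousOn.mono hBO)
  have hHc : IsCompact (entireHull X) := isCompact_entireHull hX
  obtain ⟨a, ha, haQ⟩ := ((hHc.inter_right isClosed_closedBall).diff
    (isOpen_ball (x := p) (ε := r))).exists_forall_le' (f := fun z => -(Q z).re) (a := 0)
    ((hre.mono fun z hz => hz.1.2).neg) (by
      rintro z ⟨⟨hz, hz2⟩, hz3⟩
      have hne : z ≠ p := by rintro rfl; exact hz3 (mem_ball_self hr)
      have := hneg z ⟨hz, hBO hz2⟩ hne
      linarith)
  obtain ⟨η, hη, rfl⟩ : ∃ η, 0 < η ∧ a = 2 * η := ⟨a / 2, by linarith, by ring⟩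
  set U₁ := ball p (2 * r) with hU₁
  -- On the part of the hull with r ≤ dist z p ≤ 2r, compactness gives Re Q ≤ -2η. Hence `U₁` and
  -- `U₂` cover the hull, while on U₁ ∩ U₂ one has Re Q < -η, so that Q - t has no zero there for
  -- |t| < η.
  set U₂ := (closedBall p r ∪ (closedBall p (2 * r) ∩ {z | -η ≤ (Q z).re}))ᶜ with hU₂
  have oU₁ : IsOpen U₁ := isOpen_ball
  have oU₂ : IsOpen U₂ := (isClosed_closedBall.union
    (hre.preimage_isClosed_of_isClosed isClosed_closedBall isClosed_Ici)).isOpen_compl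
  have hcov : entireHull X ⊆ U₁ ∪ U₂ := by
    intro z hz
    by_cases h : z ∈ U₁
    · exact Or.inl h
    · refine Or.inr ?_
      have hd : 2 * r ≤ dist z p := not_lt.1 h
      rintro (h' | ⟨h1, h2⟩)
      · rw [mem_closedBall] at h'; linarith
      · have := haQ z ⟨⟨hz, h1⟩, fun hb => by rw [mem_ball] at hb; linarith⟩
        have h2 : -η ≤ (Q z).re := h2
        linarith
  have hU12 : ∀ z ∈ U₁, z ∈ U₂ → (Q z).re < -η := by
    intro z h1 h2
    by_contra h
    exact h2 (Or.inr ⟨ball_subset_closedBall h1, not_lt.1 h⟩)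
  have hXU₂ : X ⊆ U₂ := by
    intro z hz h
    have : z ∈ closedBall p (2 * r) := by
      rcases h with h | h
      · exact closedBall_subset_closedBall (by linarith) h
      · exact h.1
    exact (hr₀O this).2 hz
  obtain ⟨m, K, hK, hHK, hKU⟩ := exists_isPolyhedron_of_entireHull_subset hX (oU₁.union oU₂) hcov
  have hKD := (hK.prodOption (D := closedBall 0 (η / 2)) ⟨_, half_pos hη, rfl⟩).mono
    centredDiscs_subset
  set ρ : (Option ι → ℂ) → (ι → ℂ) := fun x i => x (some i) with hρ
  have hρd : Differentiable ℂ ρ := by rw [hρ]; fun_prop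
  have hnd : Differentiable ℂ fun x : Option ι → ℂ => x none := differentiable_apply _
  have oB : IsOpen {x : Option ι → ℂ | ‖x none‖ < η} :=
    isOpen_lt hnd.continuous.norm continuous_const
  have hne : ∀ z ∈ U₁, z ∈ U₂ → ∀ t : ℂ, ‖t‖ < η → Q z - t ≠ 0 := by
    intro z h1 h2 t ht h0
    have h3 := hU12 z h1 h2
    rw [sub_eq_zero.1 h0] at h3
    have := (abs_le.1 (Complex.abs_re_le_norm t)).1
    linarith
  -- The parameter t is the extra coordinate `x none`. Solving jointly in (z, t) makes the bounds on
  -- `h₁` and `h₂` below uniform in t.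
  obtain ⟨W, h₁, h₂, hW, hKW, hh₁, hh₂, hh⟩ := hKD.cousinTrivial
    (ρ ⁻¹' U₁ ∩ {x | ‖x none‖ < η}) (ρ ⁻¹' U₂ ∩ {x | ‖x none‖ < η})
    (fun x => (Q (ρ x) - x none)⁻¹) ((oU₁.preimage hρd.continuous).inter oB)
    ((oU₂.preimage hρd.continuous).inter oB) (by
      rintro x ⟨hx, hx'⟩
      have hx' : ‖x none‖ < η := by
        rw [mem_closedBall_zero_iff] at hx'; linarith
      rcases hKU hx with h | h
      · exact Or.inl ⟨h, hx'⟩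
      · exact Or.inr ⟨h, hx'⟩) (by
      refine DifferentiableOn.fun_inv (DifferentiableOn.fun_sub ?_ hnd.differentiableOn) ?_
      · exact hQ.comp hρd.differentiableOn fun x hx => hBO (ball_subset_closedBall hx.1.1)
      · exact fun x hx => hne _ hx.1.1 hx.2.1 _ hx.1.2)
  have hmemW : ∀ z ∈ entireHull X, ∀ t ∈ Icc (0 : ℝ) (η / 2), optionCons (t : ℂ) z ∈ W := by
    intro z hz t ht
    refine hKW ⟨hHK hz, ?_⟩
    rw [mem_closedBall_zero_iff]
    change ‖(t : ℂ)‖ ≤ η / 2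
    rw [Complex.norm_real, Real.norm_of_nonneg ht.1]
    exact ht.2
  have hnorm : ∀ t ∈ Icc (0 : ℝ) (η / 2), ‖(t : ℂ)‖ < η := by
    intro t ht
    rw [Complex.norm_real, Real.norm_of_nonneg ht.1]
    linarith [ht.2]
  have hcc : Continuous fun q : ℝ × (ι → ℂ) => optionCons (q.1 : ℂ) q.2 :=
    continuous_optionCons.comp (f := fun q : ℝ × (ι → ℂ) => ((q.1 : ℂ), q.2)) (by fun_prop)
  obtain ⟨M₂, hM₂⟩ := ((isCompact_Icc (a := (0 : ℝ)) (b := η / 2)).prod hX).exists_bound_of_continuousOn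
    (f := fun q : ℝ × (ι → ℂ) => h₂ (optionCons (q.1 : ℂ) q.2))
    (hh₂.continuousOn.comp hcc.continuousOn fun q hq =>
      ⟨⟨hXU₂ hq.2, hnorm _ hq.1⟩, hmemW _ (subset_entireHull X hq.2) _ hq.1⟩)
  obtain ⟨M₁, hM₁⟩ := ((isCompact_Icc (a := (0 : ℝ)) (b := η / 2)).prod
    (isCompact_singleton (x := p))).exists_bound_of_continuousOn
    (f := fun q : ℝ × (ι → ℂ) => h₁ (optionCons (q.1 : ℂ) q.2))
    (hh₁.continuousOn.comp hcc.continuousOn fun q hq => by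
      obtain ⟨hq1, rfl⟩ := hq
      exact ⟨⟨mem_ball_self (by linarith), hnorm _ hq1⟩, hmemW _ hp _ hq1⟩)
  have hkey : ∀ t ∈ Icc (0 : ℝ) (η / 2), 0 < t → t⁻¹ ≤ max M₂ 0 + M₁ := by
    intro t ht ht0
    set c : (ι → ℂ) → (Option ι → ℂ) := fun z => optionCons (t : ℂ) z with hc
    have hcd : Differentiable ℂ c := differentiable_optionCons (differentiable_const _)
    have hQU : DifferentiableOn ℂ Q U₁ := hQ.mono (ball_subset_closedBall.trans hBO)
    have oA : IsOpen (U₁ ∩ Q ⁻¹' {(t : ℂ)}ᶜ ∩ c ⁻¹' W) :=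
      (hQU.continuousOn.isOpen_inter_preimage oU₁ isClosed_singleton.isOpen_compl).inter
        (hW.preimage hcd.continuous)
    have oA' : IsOpen (U₂ ∩ c ⁻¹' W) := oU₂.inter (hW.preimage hcd.continuous)
    -- For t > 0, Q ≠ t on the hull inside `U₁`, since Re Q ≤ 0 there. So the glued F is holomorphic
    -- near the hull. It is bounded on `X`, where it equals -h₂, but its value at p is -1/t - h₁;
    -- the hull inequality therefore bounds 1/t.
    obtain ⟨F, hF, hF1, hF2⟩ := exists_differentiableOn_union oA oA'
      (f := fun z => (Q z - t)⁻¹ - h₁ (c z)) (f' := fun z => -h₂ (c z)) (by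
        refine DifferentiableOn.fun_sub (DifferentiableOn.fun_inv
          (DifferentiableOn.fun_sub (hQU.mono fun z hz => hz.1.1) (differentiableOn_const _))
          fun z hz => sub_ne_zero.2 hz.1.2) ?_
        exact hh₁.comp hcd.differentiableOn fun z hz => ⟨⟨hz.1.1, hnorm t ht⟩, hz.2⟩)
      (DifferentiableOn.fun_neg
        (hh₂.comp hcd.differentiableOn fun z hz => ⟨⟨hz.1, hnorm t ht⟩, hz.2⟩)) (by
        rintro z ⟨⟨⟨hz1, -⟩, hzW⟩, hz2, -⟩
        have e : (Q z - t)⁻¹ = h₁ (c z) - h₂ (c z) :=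
          hh (c z) ⟨⟨⟨hz1, hnorm t ht⟩, hz2, hnorm t ht⟩, hzW⟩
        simp only [e]
        ring)
    have hHA : entireHull X ⊆ (U₁ ∩ Q ⁻¹' {(t : ℂ)}ᶜ ∩ c ⁻¹' W) ∪ (U₂ ∩ c ⁻¹' W) := by
      intro z hz
      have hzW : c z ∈ W := hmemW z hz t ht
      rcases hcov hz with h | h
      · refine Or.inl ⟨⟨h, fun hQt => ?_⟩, hzW⟩
        have hQt : Q z = t := hQt
        have : (Q z).re ≤ 0 := by
          by_cases hzp : z = p
          · rw [hzp, hQp]; simp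
          · exact (hneg z ⟨hz, hBO (ball_subset_closedBall h)⟩ hzp).le
        rw [hQt, Complex.ofReal_re] at this
        linarith
      · exact Or.inr ⟨h, hzW⟩
    have hFp := norm_le_of_mem_entireHull hX (oA.union oA') hHA hF (le_max_right M₂ 0)
      (fun x hx => by
        rw [hF2 x ⟨hXU₂ hx, hmemW x (subset_entireHull X hx) t ht⟩, norm_neg]
        exact (hM₂ (t, x) ⟨ht, hx⟩).trans (le_max_left _ _)) hp
    have hpA : p ∈ U₁ ∩ Q ⁻¹' {(t : ℂ)}ᶜ ∩ c ⁻¹' W := by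
      refine ⟨⟨mem_ball_self (by linarith), fun h => ?_⟩, hmemW p hp t ht⟩
      have h : Q p = t := h
      rw [hQp] at h
      exact ht0.ne (by exact_mod_cast h)
    rw [hF1 p hpA, hQp, zero_sub] at hFp
    have h3 := norm_sub_norm_le ((-(t : ℂ))⁻¹) (h₁ (c p))
    have h4 : ‖h₁ (c p)‖ ≤ M₁ := hM₁ (t, p) ⟨ht, rfl⟩
    have h5 : ‖(-(t : ℂ))⁻¹‖ = t⁻¹ := by
      rw [norm_inv, norm_neg, Complex.norm_real, Real.norm_of_nonneg ht0.le]
    linarith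
  set L := max (max M₂ 0 + M₁) 0 + 1 with hL
  have hLpos : 0 < L := by positivity
  have ht0 : 0 < min (η / 2) L⁻¹ := lt_min (half_pos hη) (inv_pos.2 hLpos)
  have h1 := hkey _ ⟨ht0.le, min_le_left _ _⟩ ht0
  have h2 : L ≤ (min (η / 2) L⁻¹)⁻¹ := by
    rw [le_inv_comm₀ hLpos ht0]
    exact min_le_right _ _
  have h3 := le_max_left (max M₂ 0 + M₁) 0
  linarith

end LocalPeak

/-! ### Holomorphic support functions from strict plurisubharmonicity. -/

section StrictlyPsh

variable {ι κ : Type} [Fintype ι] [Fintype κ]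

/-- The square of the Euclidean norm on `ℂ^ι`. -/
noncomputable def sumNormSq (z : ι → ℂ) : ℝ := ∑ i, ‖z i‖ ^ 2

theorem continuous_sumNormSq : Continuous (sumNormSq : (ι → ℂ) → ℝ) := by
  unfold sumNormSq; fun_prop

theorem sumNormSq_nonneg (z : ι → ℂ) : 0 ≤ sumNormSq z :=
  Finset.sum_nonneg fun _ _ => by positivity

theorem sumNormSq_eq_zero {z : ι → ℂ} : sumNormSq z = 0 ↔ ∀ i, z i = 0 := by
  rw [sumNormSq, Finset.sum_eq_zero_iff_of_nonneg fun _ _ => by positivity]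
  simp

theorem sumNormSq_pos {z : ι → ℂ} (hz : z ≠ 0) : 0 < sumNormSq z :=
  (sumNormSq_nonneg z).lt_of_ne fun h => hz (funext (sumNormSq_eq_zero.1 h.symm))

theorem sq_norm_le_sumNormSq (z : ι → ℂ) : ‖z‖ ^ 2 ≤ sumNormSq z := by
  have h : ‖z‖ ≤ √(sumNormSq z) := by
    refine (pi_norm_le_iff_of_nonneg (Real.sqrt_nonneg _)).2 fun i => Real.le_sqrt_of_sq_le ?_
    exact Finset.single_le_sum (f := fun i => ‖z i‖ ^ 2) (fun _ _ => by positivity)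
      (Finset.mem_univ i)
  calc ‖z‖ ^ 2 ≤ √(sumNormSq z) ^ 2 := by gcongr
    _ = sumNormSq z := Real.sq_sqrt (sumNormSq_nonneg z)

/-- The Hermitian pairing `∑ z i * conj (p i)`. -/
noncomputable def sumMulConj (z p : ι → ℂ) : ℂ := ∑ i, z i * (starRingEnd ℂ) (p i)

theorem sumMulConj_self (p : ι → ℂ) : sumMulConj p p = sumNormSq p := by
  simp [sumMulConj, sumNormSq, Complex.mul_conj, Complex.normSq_eq_norm_sq]

theorem sumMulConj_sub (z w p : ι → ℂ) :
    sumMulConj (z - w) p = sumMulConj z p - sumMulConj w p := by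
  simp [sumMulConj, sub_mul]

theorem differentiable_sumMulConj (p : ι → ℂ) : Differentiable ℂ fun z => sumMulConj z p := by
  unfold sumMulConj; fun_prop

theorem sumNormSq_eq_add (z p : ι → ℂ) :
    sumNormSq z = sumNormSq p + 2 * (sumMulConj (z - p) p).re + sumNormSq (z - p) := by
  simp only [sumNormSq, sumMulConj, Complex.re_sum, Finset.mul_sum, ← Finset.sum_add_distrib]
  refine Finset.sum_congr rfl fun i _ => ?_
  simp only [← Complex.normSq_eq_norm_sq, Complex.normSq_apply, Pi.sub_apply, Complex.mul_re,
    Complex.sub_re, Complex.sub_im, Complex.conj_re, Complex.conj_im]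
  ring

theorem norm_sumMulConj_sq_le (z p : ι → ℂ) :
    ‖sumMulConj z p‖ ^ 2 ≤ sumNormSq z * sumNormSq p := by
  have h1 : ‖sumMulConj z p‖ ≤ ∑ i, ‖z i‖ * ‖p i‖ := by
    refine (norm_sum_le _ _).trans_eq ?_
    simp
  calc ‖sumMulConj z p‖ ^ 2 ≤ (∑ i, ‖z i‖ * ‖p i‖) ^ 2 := by gcongr
    _ ≤ _ := Finset.sum_mul_sq_le_sq_mul_sq _ _ _

/-- Near a point `p` with `ψ p ≠ 0`, the function `exp (C |z|²) |ψ|² exp (- |ψ|² / s)` is bounded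
below by its value at `p` times `exp (Re Q)`, strictly away from `p`, for some holomorphic `Q`
vanishing at `p`. -/
theorem exists_holomorphic_support {ψ : (ι → ℂ) → (κ → ℂ)} {O : Set (ι → ℂ)} (hO : IsOpen O)
    (hψ : DifferentiableOn ℂ ψ O) {p : ι → ℂ} (hp : p ∈ O) {L s C : ℝ} (hs : 0 < s)
    (hL : ∀ z ∈ O, sumNormSq (ψ z - ψ p) ≤ L * sumNormSq (z - p)) (hC : L / s < C)
    (hψp : 0 < sumNormSq (ψ p)) :
    ∃ (O' : Set (ι → ℂ)) (Q : (ι → ℂ) → ℂ), IsOpen O' ∧ p ∈ O' ∧ O' ⊆ O ∧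
      DifferentiableOn ℂ Q O' ∧ Q p = 0 ∧ ∀ z ∈ O', z ≠ p →
        Real.exp (C * sumNormSq z) * (sumNormSq (ψ z) * Real.exp (-sumNormSq (ψ z) / s)) ≤
        Real.exp (C * sumNormSq p) * (sumNormSq (ψ p) * Real.exp (-sumNormSq (ψ p) / s)) →
        (Q z).re < 0 := by
  set R := sumNormSq (ψ p) with hR
  have hRc : (R : ℂ) ≠ 0 := by exact_mod_cast hψp.ne'
  set a : (ι → ℂ) → ℂ := fun z => sumMulConj (ψ z) (ψ p) * (R : ℂ)⁻¹ with ha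
  have had : DifferentiableOn ℂ a O :=
    ((differentiable_sumMulConj (ψ p)).comp_differentiableOn hψ).mul_const _
  have hap : a p = 1 := by
    simp only [ha, sumMulConj_self]
    exact mul_inv_cancel₀ hRc
  -- Q collects the pluriharmonic terms at p in C|z|² + log |ψ|² - |ψ|²/s. The logarithm is bounded
  -- below through |a|² R ≤ |ψ|² (Cauchy–Schwarz). What remains is at least C|z - p|² - |ψ z - ψ
  -- p|²/s, positive for z ≠ p because C > L / s.
  refine ⟨O ∩ a ⁻¹' Complex.slitPlane,
    fun z => 2 * C * sumMulConj (z - p) p + 2 * Complex.log (a z) - 2 * R / s * (a z - 1),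
    had.continuousOn.isOpen_inter_preimage hO Complex.isOpen_slitPlane,
    ⟨hp, by rw [mem_preimage, hap]; exact Complex.one_mem_slitPlane⟩, inter_subset_left, ?_, ?_, ?_⟩
  · have had' := had.mono (inter_subset_left (t := a ⁻¹' Complex.slitPlane))
    refine DifferentiableOn.fun_sub (DifferentiableOn.fun_add ?_ ?_) ?_
    · exact Differentiable.differentiableOn (Differentiable.const_mul
        ((differentiable_sumMulConj p).comp (differentiable_id.sub_const p)) _)
    · exact DifferentiableOn.const_mul (had'.clog fun z hz => hz.2) _
    · exact DifferentiableOn.const_mul (had'.sub_const 1) _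
  · simp [hap, sumMulConj]
  · rintro z ⟨hzO, hza⟩ hzp hle
    set r := sumNormSq (ψ z) with hr
    have ha0 : 0 < ‖a z‖ := norm_pos_iff.2 (Complex.slitPlane_ne_zero hza)
    have hCS : ‖a z‖ ^ 2 * R ≤ r := by
      have h1 := norm_sumMulConj_sq_le (ψ z) (ψ p)
      have h2 : ‖a z‖ ^ 2 = ‖sumMulConj (ψ z) (ψ p)‖ ^ 2 / R ^ 2 := by
        simp only [ha, norm_mul, norm_inv, Complex.norm_real, Real.norm_of_nonneg hψp.le]
        field_simp
      rw [h2, div_mul_eq_mul_div, div_le_iff₀ (by positivity)]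
      nlinarith
    have hr0 : 0 < r := lt_of_lt_of_le (by positivity) hCS
    have hlog := Real.log_le_log (by positivity) hle
    rw [Real.log_mul (Real.exp_pos _).ne' (by positivity), Real.log_mul hr0.ne' (Real.exp_pos _).ne',
      Real.log_mul (Real.exp_pos _).ne' (by positivity), Real.log_mul hψp.ne' (Real.exp_pos _).ne',
      Real.log_exp, Real.log_exp, Real.log_exp, Real.log_exp] at hlog
    have hlog2 : 2 * Real.log ‖a z‖ + Real.log R ≤ Real.log r := by
      have := Real.log_le_log (by positivity) hCS
      rwa [Real.log_mul (by positivity) hψp.ne', Real.log_pow] at this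
    have hN := sumNormSq_eq_add z p
    have hψN := sumNormSq_eq_add (ψ z) (ψ p)
    have hare : (sumMulConj (ψ z - ψ p) (ψ p)).re = R * ((a z).re - 1) := by
      have : sumMulConj (ψ z - ψ p) (ψ p) = R * (a z - 1) := by
        rw [sumMulConj_sub, sumMulConj_self, ← hR]
        simp only [ha]
        field_simp
      rw [this, Complex.re_ofReal_mul, Complex.sub_re, Complex.one_re]
    have hre : (2 * C * sumMulConj (z - p) p + 2 * Complex.log (a z) -
        2 * R / s * (a z - 1) : ℂ).re =
        2 * C * (sumMulConj (z - p) p).re + 2 * Real.log ‖a z‖ - 2 * R / s * ((a z).re - 1) := by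
      have e1 : (2 * C * sumMulConj (z - p) p : ℂ) = ((2 * C : ℝ) : ℂ) * sumMulConj (z - p) p := by
        push_cast; ring
      have e2 : (2 * Complex.log (a z) : ℂ) = ((2 : ℝ) : ℂ) * Complex.log (a z) := by
        push_cast; ring
      have e3 : (2 * R / s * (a z - 1) : ℂ) = ((2 * R / s : ℝ) : ℂ) * (a z - 1) := by
        push_cast; ring
      rw [e1, e2, e3, Complex.sub_re, Complex.add_re, Complex.re_ofReal_mul, Complex.re_ofReal_mul,
        Complex.re_ofReal_mul, Complex.log_re, Complex.sub_re, Complex.one_re]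
    change (2 * C * sumMulConj (z - p) p + 2 * Complex.log (a z) -
        2 * R / s * (a z - 1) : ℂ).re < 0
    rw [hre]
    have hd : 0 < sumNormSq (z - p) := sumNormSq_pos (sub_ne_zero.2 hzp)
    have he : sumNormSq (ψ z - ψ p) / s ≤ L / s * sumNormSq (z - p) := by
      rw [div_mul_eq_mul_div]
      exact div_le_div_of_nonneg_right (hL z hzO) hs.le
    have hCd : L / s * sumNormSq (z - p) < C * sumNormSq (z - p) := by gcongr
    have hψN' : r / s = R / s + 2 * R / s * ((a z).re - 1) + sumNormSq (ψ z - ψ p) / s := by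
      rw [hr, hψN, hare, ← hR]; ring
    rw [neg_div, neg_div, hψN', hN] at hlog
    nlinarith

end StrictlyPsh

/-! ### Convexity of the graph of the defining functions. -/

section Graph

/-- The function x exp (-x / s) is largest at x = s, by 1 + u ≤ exp u with u = x / s - 1. -/
theorem mul_exp_neg_div_le {s x : ℝ} (hs : 0 < s) :
    x * Real.exp (-x / s) ≤ s * Real.exp (-s / s) := by
  have h := Real.add_one_le_exp (x / s - 1)
  have h1 : x ≤ s * Real.exp (x / s - 1) := by
    have : x / s ≤ Real.exp (x / s - 1) := by linarith
    rwa [div_le_iff₀' hs] at this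
  calc x * Real.exp (-x / s) ≤ s * Real.exp (x / s - 1) * Real.exp (-x / s) := by gcongr
    _ = s * Real.exp (-s / s) := by
      rw [mul_assoc, ← Real.exp_add, neg_div, neg_div, div_self hs.ne']
      congr 2; ring

variable {ι κ : Type} [Fintype ι] [Fintype κ]

/-- The projection of `ℂ^(ι ⊕ κ)` to `ℂ^ι`. -/
def fstPart (x : ι ⊕ κ → ℂ) : ι → ℂ := fun i => x (Sum.inl i)

/-- The projection of `ℂ^(ι ⊕ κ)` to `ℂ^κ`. -/
def sndPart (x : ι ⊕ κ → ℂ) : κ → ℂ := fun j => x (Sum.inr j)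

theorem differentiable_fstPart : Differentiable ℂ (fstPart : (ι ⊕ κ → ℂ) → (ι → ℂ)) := by
  unfold fstPart; fun_prop

theorem differentiable_sndPart : Differentiable ℂ (sndPart : (ι ⊕ κ → ℂ) → (κ → ℂ)) := by
  unfold sndPart; fun_prop

theorem norm_fstPart_le (x : ι ⊕ κ → ℂ) : ‖fstPart x‖ ≤ ‖x‖ :=
  (pi_norm_le_iff_of_nonneg (norm_nonneg _)).2 fun _ => norm_le_pi_norm x _

theorem norm_sndPart_le (x : ι ⊕ κ → ℂ) : ‖sndPart x‖ ≤ ‖x‖ :=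
  (pi_norm_le_iff_of_nonneg (norm_nonneg _)).2 fun _ => norm_le_pi_norm x _

theorem sumNormSq_le_card_mul (w : κ → ℂ) : sumNormSq w ≤ Fintype.card κ * ‖w‖ ^ 2 := by
  calc sumNormSq w ≤ ∑ _j : κ, ‖w‖ ^ 2 :=
        Finset.sum_le_sum fun j _ => by gcongr; exact norm_le_pi_norm w j
    _ = _ := by simp

/-- The graph over a compact analytic polyhedron of its defining functions. -/
def graphOver (φ : (ι → ℂ) → (κ → ℂ)) (K : Set (ι → ℂ)) : Set (ι ⊕ κ → ℂ) :=
  {x | fstPart x ∈ K ∧ sndPart x = φ (fstPart x)}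

theorem graphOver_eq_image (φ : (ι → ℂ) → (κ → ℂ)) (K : Set (ι → ℂ)) :
    graphOver φ K = (fun z => Sum.elim z (φ z)) '' K := by
  ext x
  constructor
  · rintro ⟨h1, h2⟩
    refine ⟨fstPart x, h1, ?_⟩
    funext o
    rcases o with i | j
    · rfl
    · exact (congrFun h2 j).symm
  · rintro ⟨z, hz, rfl⟩
    exact ⟨hz, rfl⟩

theorem isCompact_graphOver {φ : (ι → ℂ) → (κ → ℂ)} {K : Set (ι → ℂ)} (hK : IsCompact K)
    (hφ : ContinuousOn φ K) : IsCompact (graphOver φ K) := by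
  rw [graphOver_eq_image]
  refine hK.image_of_continuousOn (continuousOn_pi.2 ?_)
  rintro (i | j)
  · exact (continuous_apply i).continuousOn
  · exact (continuous_apply j).comp_continuousOn hφ

/-- The graph over a compact analytic polyhedron is convex with respect to the entire functions. -/
theorem entireHull_graphOver {φ : (ι → ℂ) → (κ → ℂ)} {U K : Set (ι → ℂ)} (hU : IsOpen U)
    (hφ : DifferentiableOn ℂ φ U) (hK : IsCompact K) (hKne : K.Nonempty)
    (hKU : K = {z ∈ U | ∀ j, ‖φ z j‖ ≤ 1}) : entireHull (graphOver φ K) ⊆ graphOver φ K := by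
  have hKsub : K ⊆ U := by rw [hKU]; exact fun z hz => hz.1
  have hX : IsCompact (graphOver φ K) := isCompact_graphOver hK (hφ.continuousOn.mono hKsub)
  set X := graphOver φ K with hXdef
  set H := entireHull X with hHdef
  have hHc : IsCompact H := isCompact_entireHull hX
  have hXH : X ⊆ H := subset_entireHull X
  have hfst : Continuous (fstPart : (ι ⊕ κ → ℂ) → (ι → ℂ)) := differentiable_fstPart.continuous
  have hHsnd : ∀ x ∈ H, ∀ j, ‖sndPart x j‖ ≤ 1 := by
    intro x hx j
    refine norm_apply_le_of_mem_entireHull (X := X) (i := Sum.inr j) zero_le_one (fun y hy => ?_) hx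
    have h1 : fstPart y ∈ K := hy.1
    rw [hKU] at h1
    have h2 : y (Sum.inr j) = φ (fstPart y) j := congrFun hy.2 j
    rw [h2]
    exact h1.2 j
  obtain ⟨r₀, hr₀, hr₀U⟩ := hK.exists_cthickening_subset_open hU hKsub
  obtain ⟨r, hr, rfl⟩ : ∃ r, 0 < r ∧ r₀ = 2 * r := ⟨r₀ / 2, by linarith, by ring⟩
  set d : (ι ⊕ κ → ℂ) → ℝ := fun x => infDist (fstPart x) K with hd
  have hdc : Continuous d := (continuous_infDist_pt K).comp hfst
  have hdmem : ∀ {x : ι ⊕ κ → ℂ}, d x ≤ 2 * r → fstPart x ∈ cthickening (2 * r) K := by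
    intro x hx
    rw [hK.cthickening_eq_biUnion_closedBall hr₀.le]
    obtain ⟨y, hy, hxy⟩ := hK.exists_infDist_eq_dist hKne (fstPart x)
    exact mem_iUnion₂.2 ⟨y, hy, by rw [mem_closedBall, ← hxy]; exact hx⟩
  set ψ : (ι ⊕ κ → ℂ) → (κ → ℂ) := fun x => sndPart x - φ (fstPart x) with hψ
  have oV : ∀ t : ℝ, IsOpen {x | d x < t} := fun t => isOpen_lt hdc continuous_const
  have hψd : DifferentiableOn ℂ ψ {x | d x ≤ 2 * r} := by
    refine differentiable_sndPart.differentiableOn.sub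
      (hφ.comp differentiable_fstPart.differentiableOn fun x hx => hr₀U (hdmem hx))
  set ρ : (ι ⊕ κ → ℂ) → ℝ := fun x => sumNormSq (ψ x) with hρ
  have hρc : ContinuousOn ρ {x | d x ≤ 2 * r} :=
    continuous_sumNormSq.comp_continuousOn hψd.continuousOn
  -- Hull points satisfy |w_j| ≤ 1. If w = φ(z) with z near K, then |φ_j(z)| ≤ 1 and the description
  -- of K puts z in K.
  have hρX : ∀ x ∈ H, d x ≤ 2 * r → ρ x = 0 → x ∈ X := by
    intro x hx hdx h0
    have h1 : sndPart x = φ (fstPart x) := by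
      funext j
      exact sub_eq_zero.1 (sumNormSq_eq_zero.1 h0 j)
    refine ⟨?_, h1⟩
    rw [hKU]
    refine ⟨hr₀U (hdmem hdx), fun j => ?_⟩
    rw [← h1]
    exact hHsnd x hx j
  obtain ⟨s, hs, hsρ⟩ : ∃ s, 0 < s ∧ ∀ x ∈ H, r / 2 ≤ d x → d x ≤ r → s ≤ ρ x := by
    have hc : IsCompact (H ∩ {x | r / 2 ≤ d x ∧ d x ≤ r}) := hHc.inter_right
      ((isClosed_le continuous_const hdc).inter (isClosed_le hdc continuous_const))
    obtain ⟨s, hs, h⟩ := hc.exists_forall_le' (f := ρ) (a := 0)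
      (hρc.mono fun x hx => by
        have : d x ≤ r := hx.2.2
        change d x ≤ 2 * r
        linarith) (by
        rintro x ⟨hx, h1, h2⟩
        refine (sumNormSq_nonneg _).lt_of_ne fun h0 => ?_
        have := (hρX x hx (by linarith) h0.symm).1
        have : d x = 0 := infDist_zero_of_mem this
        linarith)
    exact ⟨s, hs, fun x hx h1 h2 => h x ⟨hx, h1, h2⟩⟩
  -- On the hull, the shell r / 2 ≤ d ≤ r has ρ ≥ s, so the truncation is already s there and
  -- extends continuously by s to the far part of the hull, where ψ may be undefined.
  set σ : (ι ⊕ κ → ℂ) → ℝ := fun x => if d x < r then min (ρ x) s else s with hσ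
  have hσfar : ∀ x ∈ H, r / 2 < d x → σ x = s := by
    intro x hx hdx
    simp only [hσ]
    split_ifs with h
    · exact min_eq_right (hsρ x hx hdx.le h.le)
    · rfl
  have hσc : ContinuousOn σ H := by
    intro x hx
    rcases lt_or_ge (d x) r with h | h
    · have h1 : ContinuousAt ρ x := (hρc.mono fun y (hy : d y < r) => by
        change d y ≤ 2 * r
        linarith).continuousAt ((oV r).mem_nhds h)
      have h2 : ContinuousAt (fun y => min (ρ y) s) x := h1.min continuousAt_const
      refine (h2.congr ?_).continuousWithinAt
      filter_upwards [(oV r).mem_nhds h] with y hy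
      exact (if_pos hy).symm
    · have h1 : ∀ᶠ y in 𝓝[H] x, s = σ y := by
        filter_upwards [self_mem_nhdsWithin, mem_nhdsWithin_of_mem_nhds
          ((isOpen_lt continuous_const hdc).mem_nhds (show r / 2 < d x by linarith))] with y hy hy'
        exact (hσfar y hy hy').symm
      exact (continuousWithinAt_const (b := s)).congr_of_eventuallyEq
        (h1.mono fun y hy => hy.symm) (hσfar x hx (by linarith))
  -- a uniform Lipschitz bound for `ψ`
  obtain ⟨M, hM⟩ := (hK.cthickening (r := 2 * r)).exists_bound_of_continuousOn
    (hφ.continuousOn.mono hr₀U)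
  set L₀ : ℝ := 2 * M / r with hL₀
  have hLip : ∀ p : ι ⊕ κ → ℂ, d p < r → ∀ x ∈ ball p r,
      sumNormSq (ψ x - ψ p) ≤ Fintype.card κ * (1 + L₀) ^ 2 * sumNormSq (x - p) := by
    intro p hp x hx
    have hsub : ball (fstPart p) r ⊆ cthickening (2 * r) K := by
      intro y hy
      rw [hK.cthickening_eq_biUnion_closedBall hr₀.le]
      obtain ⟨q, hq, hpq⟩ := hK.exists_infDist_eq_dist hKne (fstPart p)
      refine mem_iUnion₂.2 ⟨q, hq, ?_⟩
      rw [mem_closedBall]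
      have h1 := dist_triangle y (fstPart p) q
      have h2 : dist (fstPart p) q < r := hpq ▸ hp
      rw [mem_ball] at hy
      linarith
    have hpart : fstPart x - fstPart p = fstPart (x - p) := rfl
    have hxp : fstPart x ∈ ball (fstPart p) r := by
      rw [mem_ball, dist_eq_norm, hpart]
      rw [mem_ball, dist_eq_norm] at hx
      exact (norm_fstPart_le _).trans_lt hx
    have hM0 : 0 ≤ M := (norm_nonneg _).trans (hM _ (hsub (mem_ball_self hr)))
    have hL0 : 0 ≤ L₀ := by positivity
    have h1 : ‖φ (fstPart x) - φ (fstPart p)‖ ≤ L₀ * ‖x - p‖ := by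
      have hbound : ‖φ (fstPart x) - φ (fstPart p)‖ ≤ L₀ * ‖fstPart x - fstPart p‖ := by
        refine (pi_norm_le_iff_of_nonneg (by positivity)).2 fun j => ?_
        exact norm_sub_le_of_norm_le_on_ball (f := fun z => φ z j) hr
          (differentiableOn_pi.1 (hφ.mono (hsub.trans hr₀U)) j)
          (fun y hy => (norm_le_pi_norm _ j).trans (hM y (hsub hy))) hxp
      exact hbound.trans (by rw [hpart]; gcongr; exact norm_fstPart_le _)
    have h2 : ‖ψ x - ψ p‖ ≤ (1 + L₀) * ‖x - p‖ := by
      have e : ψ x - ψ p = sndPart (x - p) - (φ (fstPart x) - φ (fstPart p)) := by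
        simp only [hψ]
        have : sndPart (x - p) = sndPart x - sndPart p := rfl
        rw [this]; abel
      rw [e]
      refine (norm_sub_le _ _).trans ?_
      linarith [norm_sndPart_le (x - p)]
    calc sumNormSq (ψ x - ψ p) ≤ Fintype.card κ * ‖ψ x - ψ p‖ ^ 2 := sumNormSq_le_card_mul _
      _ ≤ Fintype.card κ * ((1 + L₀) * ‖x - p‖) ^ 2 := by gcongr
      _ = Fintype.card κ * (1 + L₀) ^ 2 * ‖x - p‖ ^ 2 := by ring
      _ ≤ _ := by gcongr; exact sq_norm_le_sumNormSq _
  set L : ℝ := Fintype.card κ * (1 + L₀) ^ 2 with hL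
  set C : ℝ := L / s + 1 with hC
  have hC0 : 0 < C := by positivity
  -- The profile t exp (-t / s) vanishes at 0 and peaks at the truncation level s, so truncating ρ
  -- at s never lowers its value. The factor exp (C|x|²) with C > L / s supplies strict
  -- plurisubharmonicity.
  set v : (ι ⊕ κ → ℂ) → ℝ := fun x =>
    Real.exp (C * sumNormSq x) * (σ x * Real.exp (-σ x / s)) with hv
  have hvc : ContinuousOn v H := by
    refine ContinuousOn.mul ?_ (hσc.mul ?_)
    · exact (Real.continuous_exp.comp (continuous_const.mul continuous_sumNormSq)).continuousOn
    · exact Real.continuous_exp.comp_continuousOn (hσc.neg.div_const s)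
  intro q hq
  by_contra hqX
  obtain ⟨p, hpH, hpmax⟩ := hHc.exists_isMaxOn ⟨q, hq⟩ hvc
  have hσpos : ∀ x ∈ H, x ∉ X → 0 < σ x := by
    intro x hx hxX
    simp only [hσ]
    split_ifs with h
    · refine lt_min ((sumNormSq_nonneg _).lt_of_ne fun h0 => ?_) hs
      exact hxX (hρX x hx (by linarith) h0.symm)
    · exact hs
  have hvp : 0 < v p := by
    have h1 : 0 < v q := by
      have := hσpos q hq hqX
      simp only [hv]
      positivity
    exact h1.trans_le (hpmax hq)
  have hpX : p ∉ X := by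
    intro hp
    have h1 : d p = 0 := infDist_zero_of_mem hp.1
    have h2 : ρ p = 0 := sumNormSq_eq_zero.2 fun j => sub_eq_zero.2 (congrFun hp.2 j)
    have h3 : σ p = 0 := by
      simp only [hσ]
      rw [h1, h2, if_pos hr, min_eq_left hs.le]
    simp only [hv, h3] at hvp
    simp at hvp
  suffices ∃ (O : Set (ι ⊕ κ → ℂ)) (Q : (ι ⊕ κ → ℂ) → ℂ), IsOpen O ∧ p ∈ O ∧
      DifferentiableOn ℂ Q O ∧ Q p = 0 ∧ ∀ z ∈ H ∩ O, z ≠ p → (Q z).re < 0 by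
    obtain ⟨O, Q, hO, hpO, hQ, hQp, hneg⟩ := this
    obtain ⟨z, hz, hzp, h0⟩ := exists_re_nonneg_of_mem_entireHull hX hpH hpX hO hpO hQ hQp
    exact absurd (hneg z hz hzp) (not_lt.2 h0)
  -- If σ = ρ at p, the maximality of v bounds the untruncated function by its value at p, and the
  -- support function applies. Otherwise σ is constantly s on the hull near p.
  by_cases hcase : d p < r ∧ ρ p ≤ s
  · obtain ⟨hdp, hρp⟩ := hcase
    have hσp : σ p = ρ p := by
      simp only [hσ]
      rw [if_pos hdp, min_eq_left hρp]
    obtain ⟨O, Q, hO, hpO, hOsub, hQ, hQp, h⟩ := exists_holomorphic_support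
      (ψ := ψ) (O := {x | d x < r} ∩ ball p r) ((oV r).inter isOpen_ball)
      (hψd.mono fun x hx => by
        have : d x < r := hx.1
        change d x ≤ 2 * r
        linarith) (p := p) ⟨hdp, mem_ball_self hr⟩ (L := L) (s := s) (C := C) hs
      (fun x hx => hLip p hdp x hx.2) (by rw [hC]; linarith)
      (by
        have := hσpos p hpH hpX
        rwa [hσp] at this)
    refine ⟨O, Q, hO, hpO, hQ, hQp, fun z hz hzp => h z hz.2 hzp ?_⟩
    have hdz : d z < r := (hOsub hz.2).1
    have hvz : v z ≤ v p := hpmax hz.1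
    simp only [hv, hσp] at hvz
    refine le_trans ?_ hvz
    refine mul_le_mul_of_nonneg_left ?_ (Real.exp_pos _).le
    change ρ z * Real.exp (-ρ z / s) ≤ _
    simp only [hσ, if_pos hdz]
    rcases le_total (ρ z) s with h' | h'
    · rw [min_eq_left h']
    · rw [min_eq_right h']
      exact mul_exp_neg_div_le hs
  · obtain ⟨O, hO, hpO, hOσ⟩ : ∃ O, IsOpen O ∧ p ∈ O ∧ ∀ z ∈ H ∩ O, σ z = s := by
      rcases lt_or_ge (d p) r with h | h
      · have hρp : s < ρ p := by
          by_contra h'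
          exact hcase ⟨h, not_lt.1 h'⟩
        refine ⟨{x | d x < r} ∩ ρ ⁻¹' Ioi s, (hρc.mono fun y (hy : d y < r) => by
          change d y ≤ 2 * r
          linarith).isOpen_inter_preimage (oV r) isOpen_Ioi, ⟨h, hρp⟩, ?_⟩
        rintro z ⟨-, hz1, hz2⟩
        have hz1 : d z < r := hz1
        have hz2 : s < ρ z := hz2
        simp only [hσ]
        rw [if_pos hz1, min_eq_right hz2.le]
      · exact ⟨{x | r / 2 < d x}, isOpen_lt continuous_const hdc,
          show r / 2 < d p by linarith, fun z hz => hσfar z hz.1 hz.2⟩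
    -- With σ constant, v z ≤ v p means |z|² ≤ |p|², whence 2 Re ⟨z - p, p⟩ ≤ -|z - p|² < 0.
    refine ⟨O, fun z => sumMulConj (z - p) p, hO, hpO, Differentiable.differentiableOn
      ((differentiable_sumMulConj p).comp (differentiable_id.sub_const p)), ?_, ?_⟩
    · simp [sumMulConj]
    · intro z hz hzp
      have hvz : v z ≤ v p := hpmax hz.1
      simp only [hv, hOσ z hz, hOσ p ⟨hpH, hpO⟩] at hvz
      have h1 := le_of_mul_le_mul_right hvz (by positivity)
      rw [Real.exp_le_exp] at h1
      have h2 := le_of_mul_le_mul_left h1 hC0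
      rw [sumNormSq_eq_add z p] at h2
      have := sumNormSq_pos (sub_ne_zero.2 hzp)
      simp only
      linarith

end Graph

/-! ### The approximation theorem, by restriction to the graph. -/

theorem theorem3 {n : ℕ} (Ω Δ : Set (Fin n → ℂ)) (hΩo : IsOpen Ω) (hΩc : IsConnected Ω)
    (hΔ : IsAnalyticPolyhedron Ω Δ) (f : (Fin n → ℂ) → ℂ) (hf : HolomorphicNear f (closure Δ)) :
    ∀ ε : ℝ, 0 < ε → ∃ F : (Fin n → ℂ) → ℂ, DifferentiableOn ℂ F Ω ∧
      ∀ z ∈ closure Δ, ‖f z - F z‖ < ε := by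
  intro ε hε
  obtain ⟨hK, hKΩ, m, φ, U, hφ, hU, hUΩ, -, hKU⟩ := hΔ
  obtain ⟨V, hV, hKV, hfV⟩ := hf
  rcases (closure Δ).eq_empty_or_nonempty with he | hne
  · exact ⟨0, differentiableOn_const 0, by simp [he]⟩
  set Φ : (Fin n → ℂ) → (Fin m → ℂ) := fun z j => φ j z with hΦ
  have hΦd : DifferentiableOn ℂ Φ Ω := differentiableOn_pi.2 hφ
  have hhull : entireHull (graphOver Φ (closure Δ)) ⊆ graphOver Φ (closure Δ) :=
    entireHull_graphOver hU (hΦd.mono hUΩ) hK hne hKU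
  -- The function approximated is f composed with the projection to the first n coordinates.
  obtain ⟨G, hG, h⟩ := exists_entire_approx_of_entireHull_subset
    (isCompact_graphOver hK (hΦd.continuousOn.mono hKΩ))
    (hV.preimage (differentiable_fstPart (ι := Fin n) (κ := Fin m)).continuous)
    (fun x hx => hKV (hhull hx).1)
    (hfV.comp differentiable_fstPart.differentiableOn fun x hx => hx) hε
  have hmem : ∀ z ∈ closure Δ, Sum.elim z (Φ z) ∈ graphOver Φ (closure Δ) := fun z hz =>
    ⟨hz, rfl⟩
  refine ⟨fun z => G (Sum.elim z (Φ z)), ?_, fun z hz => h _ (subset_entireHull _ (hmem z hz))⟩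
  refine hG.comp_differentiableOn (differentiableOn_pi.2 ?_)
  rintro (i | j)
  · exact (differentiable_apply i).differentiableOn
  · exact hφ j
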